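/- Setting. Let $X$ be a Polish space, let $Y,\mathcal H,\mathcal H'$ be real separable Hilbert spaces, and let $\rho$ be a probability measure on $X\times Y$ with marginal $\nu$ on $X$, regular conditional distribution $\rho(y|x)$ and $\int\|y\|_Y^2\,d\rho<\infty$. Let $\mathcal H'$ be a reproducing kernel Hilbert space of functions $X\to Y$, and let $K_x:Y\to\mathcal H'$ be the adjoint of the evaluation at $x$. Assume that $\|K_x\|_{HS}^2\le\kappa^2$ for all $x\in X$ and that $(x,t)\mapsto\langle K_tv,K_xw\rangle_{\mathcal H'}$ is measurable for all $v,w\in Y$. Let $I_\nu:\mathcal H'\to L^2(X,\nu;Y)$ be the canonical injection, $T_\nu=I_\nu^*I_\nu$ and $\mathcal N(\lambda)=\mathrm{Tr}((T_\nu+\lambda I)^{-1}T_\nu)$. Let $L:\mathcal D(L)\subset\mathcal H\to\mathcal H$ be densely defined, closed, self-adjoint and strictly positive, with $\ell_L\|f\|\le\|Lf\|$ on $\mathcal D(L)$ for some $\ell_L>0$. For $a\ge0$ put $\|f\|_{-a}=\|L^{-a}f\|_{\mathcal H}$ for $f\in\mathcal H$, and $\|f\|_a=\|L^af\|_{\mathcal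 H}$ for $f\in\mathcal H_a=\mathcal D(L^a)$. Let $A:\mathcal D(A)\to\mathcal H'$, where $\mathcal D(A)\subset\mathcal H$ is convex and closed, be weak-to-weak sequentially continuous. Assume that $y$ is integrable with respect to $\rho(\cdot|x)$ for $\nu$-almost every $x$, and that there is a unique $\hat f\in\mathrm{int}(\mathcal D(A))$ with $\int_Yy\,d\rho(y|x)=A(\hat f)(x)$ for all $x\in X$. Assume that the noise $\varepsilon=y-A(\hat f)(x)$ satisfies, for $\nu$-almost every $x$ and constants $M>0$, $\Sigma$, $$\int_Y\Big(e^{\|\varepsilon\|_Y/M}-\tfrac{\|\varepsilon\|_Y}{M}-1\Big)d\rho(y|x)\le\frac{\Sigma^2}{2M^2}.$$ Let $p\ge0$, $s>0$, $\alpha>0$, $\theta\ge0$, $d>0$, $r>0$, and let $Q\subset\mathcal D(A)$ be such that every $f\in Q$ satisfies $f-\hat f\in\mathcal H_\theta$, $\|f-\hat f\|_\theta\le d$, $\|f-\hat f\|_{\mathcal H}\le r$ and the conditional stability estimate $$\|f-\hat f\|_{-p}\le\alpha\,\|I_\nu[A(f)-A(\hat f)]\|_{L^2(X,\nu;Y)}^{s}.$$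 Assume that $A$ is Lipschitz with constant $\ell_A\ge0$ on $\{f\in\mathcal D(A):\|f-\hat f\|_{\mathcal H}\le r\}$. Let $\bar f\in\mathcal D(A)\cap\mathcal D(L)$ and let $1\le q\le2+p$ and $q(s-1)<p+s$. For a sample $\mathbf z=((x_i,y_i))_{i=1}^m$, $m\ge 1$, of independent draws from $\rho$, let $f_{\mathbf z,\lambda}$ denote any minimizer over $f\in\mathcal D(A)\cap\mathcal D(L)$ of $$\frac1m\sum_{i=1}^m\|A(f)(x_i)-y_i\|_Y^2+\lambda\|L(f-\bar f)\|_{\mathcal H}^2 .$$ For $R>0$ let $\hat f^R$ be the minimizer of $\|f-\hat f\|_{\mathcal H}$ over all $f$ of the form $f=\bar f+L^{-q}v$ with $\|v\|_{\mathcal H}\le R$, and put $d_A(R)=\|I_\nu[A(\hat f^R)-A(\hat f)]\|_{L^2(X,\nu;Y)}$. Theorem. There is a constant $\widetilde C>0$, depending only on $p,q,s,\kappa,M,\Sigma,\alpha$, $\ell=\ell_A/\ell_L$, $\ell_1=2\ell_Ar$ and $\mathcal N(1)$, with the following property. Let $0<\lambda\le1$, $m\ge1$ and $\mathcal N(\lambda)\le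 m\lambda$, and let $R=R(\lambda)>0$ be such that either $d_A(R)=0$, or $R$ solves the balancing equation $$d_A(R)\,R^{-\frac{p+1}{(p+q)-s(q-1)}}=\lambda^{\frac{p+q}{2(p+q)-2s(q-1)}} .$$ Suppose $\hat f^R\in Q$ and put $$\mathcal B=\sqrt{\frac{\mathcal N(\lambda)}{m\lambda}}+R(\lambda)^{\frac{p+1}{(p+q)-s(q-1)}}\,\lambda^{\frac{s(q-1)}{2(p+q)-2s(q-1)}} .$$ Then, for every $0<\eta<1$, there is an event of $\rho^{\otimes m}$-probability at least $1-\eta$ on which every minimizer $f_{\mathbf z,\lambda}\in Q$ satisfies $$\|I_\nu[A(f_{\mathbf z,\lambda})-A(\hat f^R)]\|_{L^2(X,\nu;Y)}\le\widetilde C\lambda^{1/2}\,\mathcal B\,\log\tfrac4\eta,$$ $$f_{\mathbf z,\lambda}-\hat f^R\in\mathcal D(L),\qquad\|L(f_{\mathbf z,\lambda}-\hat f^R)\|_{\mathcal H}\le\widetilde C\,\mathcal B\,\log\tfrac4\eta,$$ $$\|f_{\mathbf z,\lambda}-\hat f^R\|_{\mathcal H}\le\widetilde C\lambda^{\frac{s}{2(p+1)}}\,\mathcal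 B^{\frac{p+s}{p+1}}\Big(\log\tfrac4\eta\Big)^{\max\{1,\frac{p+s}{p+1}\}} .$$ (For $s\le1$ the last exponent of the logarithm is $1$.) -/

import Mathlib

open MeasureTheory ProbabilityTheory Filter Topology
open scoped ENNReal NNReal

universe u v w t

set_option linter.unusedSectionVars false

namespace HilbertScale

noncomputable section

/-! ### Bounded operators on real Hilbert spaces: Hilbert-Schmidt norm and trace -/

section Operators

variable (E : Type*) [NormedAddCommGroup E] [InnerProductSpace ℝ E] [CompleteSpace E]

/-- Index set of a fixed orthonormal basis of the Hilbert space `E`. -/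
def onbIndex : Set E := (exists_hilbertBasis ℝ E).choose

/-- A fixed orthonormal basis of the Hilbert space `E`. -/
def onb : HilbertBasis (onbIndex E) ℝ E := (exists_hilbertBasis ℝ E).choose_spec.choose

variable {E}

/-- The squared Hilbert-Schmidt norm `∑ᵢ ‖T eᵢ‖²` (independent of the orthonormal basis). -/
def hsNormSq {F : Type*} [NormedAddCommGroup F] [InnerProductSpace ℝ F] (T : E →L[ℝ] F) : ℝ≥0∞ :=
  ∑' i, ENNReal.ofReal (‖T (onb E i)‖ ^ 2)

/-- The trace `∑ᵢ ⟨T eᵢ, eᵢ⟩` (of a trace class operator). -/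
def opTrace (T : E →L[ℝ] E) : ℝ := ∑' i, inner ℝ (T (onb E i)) (onb E i)

theorem norm_adjoint_le_of_hsNormSq_le {F : Type*} [NormedAddCommGroup F] [InnerProductSpace ℝ F]
    [CompleteSpace F] (T : E →L[ℝ] F) (c : ℝ) (h : hsNormSq T ≤ ENNReal.ofReal (c ^ 2)) (g : F) :
    ‖T.adjoint g‖ ≤ |c| * ‖g‖ := by
  have hfin : hsNormSq T ≠ ∞ := ne_top_of_le_ne_top ENNReal.ofReal_ne_top h
  have hsum : Summable fun i => ‖T (onb E i)‖ ^ 2 := by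
    have := ENNReal.summable_toReal hfin
    refine this.congr fun i => ?_
    exact ENNReal.toReal_ofReal (sq_nonneg _)
  have hle : ∑' i, ‖T (onb E i)‖ ^ 2 ≤ c ^ 2 := by
    rw [hsNormSq, ← ENNReal.ofReal_tsum_of_nonneg (fun i => sq_nonneg _) hsum] at h
    exact (ENNReal.ofReal_le_ofReal_iff (sq_nonneg c)).1 h
  have h1 := (onb E).hasSum_inner_mul_inner (T.adjoint g) (T.adjoint g)
  have h2 : ‖T.adjoint g‖ ^ 2 ≤ (∑' i, ‖T (onb E i)‖ ^ 2) * ‖g‖ ^ 2 := by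
    rw [← real_inner_self_eq_norm_sq, ← h1.tsum_eq, ← tsum_mul_right]
    refine h1.summable.tsum_le_tsum (fun i => ?_) (hsum.mul_right _)
    rw [real_inner_comm (T.adjoint g) (onb E i), ContinuousLinearMap.adjoint_inner_left]
    have := abs_real_inner_le_norm g (T (onb E i))
    rw [← mul_pow, ← sq, ← sq_abs, mul_comm ‖T (onb E i)‖]
    gcongr
  refine abs_le_of_sq_le_sq' ?_ (by positivity) |>.2
  rw [mul_pow, sq_abs]
  exact h2.trans (by gcongr)

theorem countable_onbIndex [TopologicalSpace.SeparableSpace E] : Countable (onbIndex E) := by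
  refine Pairwise.countable_of_isOpen_disjoint
    (s := fun i : onbIndex E => Metric.ball (onb E i) (1 / 2)) ?_ (fun _ => Metric.isOpen_ball)
    (fun i => ⟨onb E i, Metric.mem_ball_self (by norm_num)⟩)
  intro i j hij
  refine Metric.ball_disjoint_ball ?_
  have ho := (onb E).orthonormal
  have h : ‖onb E i - onb E j‖ ^ 2 = 2 := by
    rw [norm_sub_sq_real, ho.1 i, ho.1 j, ho.2 hij]; norm_num
  rw [dist_eq_norm]
  nlinarith [norm_nonneg (onb E i - onb E j)]

theorem measurable_of_inner [TopologicalSpace.SeparableSpace E] [MeasurableSpace E] [BorelSpace E]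
    {X : Type*} [MeasurableSpace X] {f : X → E} (h : ∀ w : E, Measurable fun x => inner ℝ w (f x)) :
    Measurable f := by
  have : SecondCountableTopology E := UniformSpace.secondCountable_of_separable E
  have := countable_onbIndex (E := E)
  have : (atTop : Filter (Finset (onbIndex E))).IsCountablyGenerated := inferInstance
  refine measurable_of_tendsto_metrizable'
    (f := fun s x => ∑ i ∈ s, (inner ℝ (onb E i) (f x)) • onb E i) atTop ?_ ?_
  · intro s
    exact Finset.measurable_sum _ fun i _ => (h _).smul_const _
  · rw [tendsto_pi_nhds]
    intro x
    have := (onb E).hasSum_repr (f x)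
    simp only [(onb E).repr_apply_apply] at this
    exact this

end Operators

/-! ### The Hilbert scale generated by an unbounded operator -/

section Scale

variable {H : Type*} [NormedAddCommGroup H] [InnerProductSpace ℝ H] [CompleteSpace H]

/-- `L` is a densely defined, closed, self-adjoint, strictly positive operator with
`ℓL ‖f‖ ≤ ‖L f‖` on its domain. -/
structure IsScaleGenerator (L : H →ₗ.[ℝ] H) (ℓL : ℝ) : Prop where
  dense_domain : Dense (L.domain : Set H)
  isClosed : L.IsClosed
  isSelfAdjoint : IsSelfAdjoint L
  pos : ∀ f : L.domain, f ≠ 0 → 0 < inner ℝ (L f) (f : H)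
  lower_pos : 0 < ℓL
  lower : ∀ f : L.domain, ℓL * ‖(f : H)‖ ≤ ‖L f‖

/-- A bounded everywhere defined operator `B` with range in the domain of `L` and `L B = 1`. -/
def IsRightInverse (L : H →ₗ.[ℝ] H) (B : H →L[ℝ] H) : Prop :=
  ∀ x, ∃ h : B x ∈ L.domain, L ⟨B x, h⟩ = x

open Classical in
/-- The bounded operator `L⁻¹`. -/
def invOp (L : H →ₗ.[ℝ] H) : H →L[ℝ] H :=
  if h : ∃ B : H →L[ℝ] H, IsRightInverse L B then h.choose else 0

theorem IsScaleGenerator.surjective {L : H →ₗ.[ℝ] H} {ℓL : ℝ} (hL : IsScaleGenerator L ℓL) :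
    ∀ x, ∃ f : L.domain, L f = x := by
  have hcl : IsClosed (Set.range L) := by
    refine isSeqClosed_iff_isClosed.1 ?_
    intro y y' hy hlim
    choose f hf using hy
    have hc : CauchySeq fun n => (f n : H) := by
      have hy := hlim.cauchySeq
      rw [Metric.cauchySeq_iff'] at hy ⊢
      intro ε hε
      obtain ⟨N, hN⟩ := hy (ℓL * ε) (mul_pos hL.lower_pos hε)
      refine ⟨N, fun n hn => ?_⟩
      have h1 := hL.lower (f n - f N)
      have h2 := hN n hn
      rw [dist_eq_norm, ← hf, ← hf, ← LinearPMap.map_sub] at h2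
      rw [dist_eq_norm]
      exact lt_of_mul_lt_mul_left (h1.trans_lt h2) hL.lower_pos.le
    obtain ⟨x, hx⟩ := cauchySeq_tendsto_of_complete hc
    have hg : (x, y') ∈ (L.graph : Set (H × H)) := by
      refine IsClosed.mem_of_tendsto hL.isClosed (hx.prodMk_nhds hlim) (Eventually.of_forall ?_)
      intro n
      exact L.mem_graph_iff.2 ⟨f n, rfl, hf n⟩
    obtain ⟨z, -, hz⟩ := L.mem_graph_iff.1 hg
    exact ⟨z, hz⟩
  let R : Submodule ℝ H := LinearMap.range L.toFun
  have hRcl : IsClosed (R : Set H) := by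
    have : (R : Set H) = Set.range L := by ext; simp [R]
    rw [this]; exact hcl
  have hbot : Rᗮ = ⊥ := by
    rw [Submodule.eq_bot_iff]
    intro g hg
    rw [Submodule.mem_orthogonal'] at hg
    have h0 : ∀ x : L.domain, inner ℝ (0 : H) (x : H) = inner ℝ g (L x) := fun x => by
      rw [inner_zero_left]; exact (hg _ ⟨x, rfl⟩).symm
    have hg' : g ∈ L.adjoint.domain := LinearPMap.mem_adjoint_domain_of_exists g ⟨0, h0⟩
    have hval := LinearPMap.adjoint_apply_eq hL.dense_domain ⟨g, hg'⟩ h0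
    have hgr : (g, (0 : H)) ∈ L.adjoint.graph := L.adjoint.mem_graph_iff.2 ⟨⟨g, hg'⟩, rfl, hval⟩
    rw [LinearPMap.isSelfAdjoint_def.1 hL.isSelfAdjoint] at hgr
    obtain ⟨z, hz, hz0⟩ := L.mem_graph_iff.1 hgr
    have h1 := hL.lower z
    simp only at hz hz0
    rw [hz0, norm_zero, hz] at h1
    have := hL.lower_pos
    have h2 : ‖g‖ ≤ 0 := by
      by_contra hh
      push Not at hh
      nlinarith
    simpa using h2
  have : CompleteSpace R := hRcl.completeSpace_coe
  have htop : R = ⊤ := by rwa [Submodule.orthogonal_eq_bot_iff] at hbot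
  intro x
  have : x ∈ R := by rw [htop]; trivial
  exact this

theorem IsScaleGenerator.exists_inverse {L : H →ₗ.[ℝ] H} {ℓL : ℝ} (hL : IsScaleGenerator L ℓL) :
    ∃ B : H →L[ℝ] H, IsRightInverse L B := by
  have hinj : ∀ f g : L.domain, L f = L g → f = g := fun f g h => by
    have h1 := hL.lower (f - g)
    rw [LinearPMap.map_sub, h, sub_self, norm_zero] at h1
    have h2 : ‖((f - g : L.domain) : H)‖ ≤ 0 := by
      by_contra hh
      push Not at hh
      nlinarith [hL.lower_pos]
    have h3 : ((f - g : L.domain) : H) = 0 := by simpa using h2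
    exact sub_eq_zero.1 (Subtype.ext h3)
  choose S hS using hL.surjective
  let B₀ : H →ₗ[ℝ] H :=
    { toFun := fun x => S x
      map_add' := fun x y => by
        rw [← Submodule.coe_add]
        exact congrArg _ (hinj _ _ (by rw [LinearPMap.map_add, hS, hS, hS]))
      map_smul' := fun c x => by
        rw [RingHom.id_apply, ← Submodule.coe_smul]
        exact congrArg _ (hinj _ _ (by rw [LinearPMap.map_smul, hS, hS])) }
  refine ⟨B₀.mkContinuous ℓL⁻¹ fun x => ?_, fun x => ⟨(S x).2, hS x⟩⟩
  have := hL.lower (S x)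
  rw [hS] at this
  rw [inv_mul_eq_div, le_div_iff₀ hL.lower_pos, mul_comm]
  exact this

theorem IsScaleGenerator.isRightInverse_invOp {L : H →ₗ.[ℝ] H} {ℓL : ℝ}
    (hL : IsScaleGenerator L ℓL) : IsRightInverse L (invOp L) := by
  rw [invOp, dif_pos hL.exists_inverse]
  exact hL.exists_inverse.choose_spec

/-- The bounded operator `L^{-a}` for `a ≥ 0`. With `B = L⁻¹` and `C = B / ‖B‖` one has
`0 ≤ C ≤ 1`, and `C ^ a = (1 - (1 - C)) ^ a` is given by the binomial series, which converges
absolutely in operator norm: on the spectrum of `1 - C`, which lies in `[0, 1]`, the binomial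
series `∑ₖ (-1)ᵏ (a choose k) yᵏ` converges uniformly to `(1 - y) ^ a`. Hence this is the power of
`L⁻¹` in the sense of the spectral calculus. -/
def negPow (L : H →ₗ.[ℝ] H) (a : ℝ) : H →L[ℝ] H :=
  ‖invOp L‖ ^ a • ∑' k : ℕ, ((-1) ^ k * Ring.choose a k) • (1 - ‖invOp L‖⁻¹ • invOp L) ^ k

/-- The binomial coefficients in the series defining `L^{-a}` are absolutely summable. -/
theorem summable_abs_choose {a : ℝ} (ha : 0 ≤ a) : Summable fun k : ℕ => |Ring.choose a k| := by
  rcases ha.eq_or_lt with rfl | ha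
  · refine summable_of_hasFiniteSupport ((Set.finite_singleton 0).subset fun k hk => ?_)
    by_contra h
    exact hk (by simp [Ring.choose_zero_pos ℝ (Nat.pos_of_ne_zero h)])
  have hrec : ∀ k : ℕ, (k + 1 : ℝ) * Ring.choose a (k + 1) = (a - k) * Ring.choose a k := by
    intro k
    have := Ring.choose_smul_choose a (n := k + 1) (k := k) (by omega)
    simp only [Nat.choose_succ_self_right, add_tsub_cancel_left, Ring.choose_one_right,
      nsmul_eq_mul] at this
    push_cast at this
    rw [this]; ring
  obtain ⟨K, hK⟩ := exists_nat_ge a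
  rw [← summable_nat_add_iff K]
  refine summable_of_sum_range_le (c := (K : ℝ) * |Ring.choose a K| / a) (fun _ => abs_nonneg _)
    fun n => ?_
  rw [le_div_iff₀ ha]
  have key : ∀ n : ℕ, (∑ i ∈ Finset.range n, |Ring.choose a (i + K)|) * a
      = K * |Ring.choose a K| - (n + K : ℕ) * |Ring.choose a (n + K)| := by
    intro n
    induction n with
    | zero => simp
    | succ n ih =>
      rw [Finset.sum_range_succ, add_mul, ih]
      have h := congrArg abs (hrec (n + K))
      have h0 : (0 : ℝ) ≤ n := n.cast_nonneg
      have h1 : (0 : ℝ) ≤ ((n + K : ℕ) : ℝ) + 1 := by positivity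
      have h2 : a - ((n + K : ℕ) : ℝ) ≤ 0 := by push_cast; linarith
      rw [abs_mul, abs_mul, abs_of_nonneg h1, abs_of_nonpos h2] at h
      have e : n + 1 + K = n + K + 1 := by omega
      rw [e]
      push_cast at h ⊢
      linarith
  rw [key]
  have : 0 ≤ ((n + K : ℕ) : ℝ) * |Ring.choose a (n + K)| := by positivity
  linarith

theorem negPow_zero (L : H →ₗ.[ℝ] H) : negPow L 0 = 1 := by
  rw [negPow, Real.rpow_zero, one_smul, tsum_eq_single 0]
  · simp
  · intro k hk
    rw [Ring.choose_zero_pos ℝ (Nat.pos_of_ne_zero hk)]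
    simp

theorem negPow_one (L : H →ₗ.[ℝ] H) : negPow L 1 = invOp L := by
  rw [negPow, Real.rpow_one, tsum_eq_sum (s := Finset.range 2)]
  · rcases eq_or_ne (invOp L) 0 with h | h
    · simp [h]
    · have : ‖invOp L‖ ≠ 0 := norm_ne_zero_iff.2 h
      simp [Finset.sum_range_succ, smul_smul, this]
  · intro k hk
    have hk : 1 < k := by simpa using hk
    have := Ring.choose_natCast (R := ℝ) 1 k
    rw [Nat.choose_eq_zero_of_lt hk, Nat.cast_one, Nat.cast_zero] at this
    rw [this]; simp

/-- The ball of radius `r` around `c` in the space `H_a`, for `a ≥ 0`: all `f` such that `f - c`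
lies in `H_a = 𝒟(L^a) = Ran(L^{-a})` and `‖L^a (f - c)‖ ≤ r`, i.e. `f - c = L^{-a} v` with
`‖v‖ ≤ r`. -/
def scaleBall (L : H →ₗ.[ℝ] H) (a : ℝ) (c : H) (r : ℝ) : Set H :=
  {f | ∃ v : H, f - c = negPow L a v ∧ ‖v‖ ≤ r}

/-- `fR` is the minimizing element `f̂^R` of the distance function
`d(R) = inf {‖f - f̂‖ : f - f̄ = L^{-q} v, ‖v‖ ≤ R}`. -/
def IsDistMinimizer (L : H →ₗ.[ℝ] H) (q : ℝ) (fbar fhat : H) (R : ℝ) (fR : H) : Prop :=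
  fR ∈ scaleBall L q fbar R ∧ IsMinOn (fun f => ‖f - fhat‖) (scaleBall L q fbar R) fR

end Scale

/-! ### The reproducing kernel Hilbert space and its covariance operator -/

section Kernel

variable {X : Type*} [MeasurableSpace X]
  {Y : Type*} [NormedAddCommGroup Y] [InnerProductSpace ℝ Y] [CompleteSpace Y]
  {H' : Type*} [NormedAddCommGroup H'] [InnerProductSpace ℝ H'] [CompleteSpace H'] [RKHS ℝ H' X Y]

variable (H') in
/-- The kernel operators `K_x : Y → H'` are Hilbert-Schmidt with `‖K_x‖²_HS ≤ κ²` for all `x`, and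
`(x, t) ↦ ⟨K_t v, K_x w⟩` is measurable for all `v, w ∈ Y`. -/
structure KernelAssumption (κ : ℝ) : Prop where
  hs_le : ∀ x : X, hsNormSq (RKHS.kerFun H' x) ≤ ENNReal.ofReal (κ ^ 2)
  measurable : ∀ v w : Y, Measurable fun z : X × X =>
    inner ℝ (RKHS.kerFun H' z.2 v) (RKHS.kerFun H' z.1 w)

theorem KernelAssumption.norm_apply_le {κ : ℝ} (hK : KernelAssumption H' κ) (g : H') (x : X) :
    ‖g x‖ ≤ |κ| * ‖g‖ := by
  rw [← RKHS.adjoint_kerFun]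
  exact norm_adjoint_le_of_hsNormSq_le _ _ (hK.hs_le x) g

variable [MeasurableSpace Y] [BorelSpace Y] [TopologicalSpace.SeparableSpace Y]

theorem KernelAssumption.measurable_coe {κ : ℝ} (hK : KernelAssumption H' κ) (g : H') :
    Measurable (g : X → Y) := by
  refine measurable_of_inner fun w => ?_
  have hg : g ∈ (Submodule.span ℝ
      {h : H' | ∃ (x : X) (v : Y), RKHS.kerFun H' x v = h}).topologicalClosure := by
    rw [RKHS.kerFun_dense]; trivial
  rw [← SetLike.mem_coe, Submodule.topologicalClosure_coe, mem_closure_iff_seq_limit] at hg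
  obtain ⟨G, hG, hlim⟩ := hg
  refine measurable_of_tendsto_metrizable (f := fun n x => inner ℝ w ((G n : X → Y) x)) ?_ ?_
  · intro n
    refine Submodule.span_induction (R := ℝ) (M := H')
      (p := fun h _ => Measurable fun x => inner ℝ w ((h : X → Y) x))
      ?_ ?_ ?_ ?_ (hG n)
    · rintro _ ⟨t, v, rfl⟩
      have := (hK.measurable v w).comp (measurable_id.prodMk (measurable_const (a := t)))
      convert this using 1
      funext x
      simp only [Function.comp, id]
      rw [RKHS.inner_kerFun, real_inner_comm]
    · simp
    · intro a b _ _ ha hb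
      simp only [RKHS.coe_add, Pi.add_apply, inner_add_right]
      exact ha.add hb
    · intro c a _ ha
      simpa [inner_smul_right] using ha.const_mul c
  · rw [tendsto_pi_nhds]
    intro x
    exact tendsto_const_nhds.inner (((RKHS.continuous_eval x).tendsto g).comp hlim)

theorem KernelAssumption.memLp {κ : ℝ} (hK : KernelAssumption H' κ) (ν : Measure X)
    [IsProbabilityMeasure ν] (g : H') : MemLp (g : X → Y) 2 ν := by
  have : SecondCountableTopology Y := UniformSpace.secondCountable_of_separable Y
  exact MemLp.of_bound (hK.measurable_coe g).aestronglyMeasurable (|κ| * ‖g‖)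
    (Eventually.of_forall (hK.norm_apply_le g))

/-- The canonical injection `I_ν : H' → L²(X, ν; Y)`. -/
def inclusion {κ : ℝ} (hK : KernelAssumption H' κ) (ν : Measure X) [IsProbabilityMeasure ν] :
    H' →L[ℝ] Lp Y 2 ν :=
  LinearMap.mkContinuous
    { toFun := fun g => (hK.memLp ν g).toLp g
      map_add' := fun f g => by
        rw [← MemLp.toLp_add]; congr 1; exact RKHS.coe_add f g
      map_smul' := fun c g => by
        rw [RingHom.id_apply, ← MemLp.toLp_const_smul]; congr 1; exact RKHS.coe_smul g c }
    |κ| fun g => by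
      have h := Lp.norm_le_of_ae_bound (f := (hK.memLp ν g).toLp g)
        (C := |κ| * ‖g‖) (by positivity) (by
          filter_upwards [(hK.memLp ν g).coeFn_toLp] with x hx
          rw [hx]; exact hK.norm_apply_le g x)
      simpa [measureUnivNNReal] using h

/-- The covariance operator `T_ν = I_ν^* I_ν`. -/
def covariance {κ : ℝ} (hK : KernelAssumption H' κ) (ν : Measure X) [IsProbabilityMeasure ν] :
    H' →L[ℝ] H' :=
  (inclusion hK ν).adjoint ∘L inclusion hK ν

/-- The effective dimension `N(λ) = Tr((T_ν + λ I)⁻¹ T_ν)`. -/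
def effDim {κ : ℝ} (hK : KernelAssumption H' κ) (ν : Measure X) [IsProbabilityMeasure ν]
    (lam : ℝ) : ℝ :=
  opTrace (Ring.inverse (covariance hK ν + lam • 1) * covariance hK ν)

end Kernel

/-! ### The statistical inverse problem -/

section Model

variable {X : Type*} [MeasurableSpace X]
  {Y : Type*} [NormedAddCommGroup Y] [InnerProductSpace ℝ Y] [CompleteSpace Y]
  [MeasurableSpace Y] [BorelSpace Y] [TopologicalSpace.SeparableSpace Y]
  {H : Type*} [NormedAddCommGroup H] [InnerProductSpace ℝ H] [CompleteSpace H]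
  {H' : Type*} [NormedAddCommGroup H'] [InnerProductSpace ℝ H'] [CompleteSpace H'] [RKHS ℝ H' X Y]

/-- The sampling distribution `ρ` has a finite second moment in `y`, and `ρ(y|x) = k x` is a regular
conditional distribution of `y` given `x`. -/
structure IsSamplingModel (ρ : Measure (X × Y)) (k : Kernel X Y) : Prop where
  integrable_sq : Integrable (fun z : X × Y => ‖z.2‖ ^ 2) ρ
  disintegration : ρ = ρ.fst ⊗ₘ k

/-- `fhat` is the unique interior point of the domain `DA` of `A` for which
`A fhat (x)` is the conditional expectation of `y` given `x`, for all `x`. -/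
structure IsTrueSolution (ρ : Measure (X × Y)) (k : Kernel X Y) (DA : Set H) (A : H → H')
    (fhat : H) : Prop where
  exists_condExp : ∀ᵐ x ∂ρ.fst, Integrable (fun y => y) (k x)
  mem_interior : fhat ∈ interior DA
  condExp_eq : ∀ x : X, ∫ y, y ∂(k x) = A fhat x
  unique : ∀ f ∈ interior DA, (∀ x : X, ∫ y, y ∂(k x) = A f x) → f = fhat

/-- Bernstein-type condition on the noise `ε = y - A fhat (x)`. -/
def NoiseCondition (ρ : Measure (X × Y)) (k : Kernel X Y) (A : H → H') (fhat : H) (M Sig : ℝ) :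
    Prop :=
  ∀ᵐ x ∂ρ.fst, ∫⁻ y, ENNReal.ofReal
    (Real.exp (‖y - A fhat x‖ / M) - ‖y - A fhat x‖ / M - 1) ∂(k x)
      ≤ ENNReal.ofReal (Sig ^ 2 / (2 * M ^ 2))

/-- The structural assumptions on the nonlinear operator `A` with domain `DA`: convex closed domain,
weak-to-weak sequential continuity, Lipschitz continuity with constant `ℓA` on the intersection
of `DA` with the closed ball of radius `r` around `fhat`, and the conditional stability
estimate on `Q`, where `Q` is contained in `DA`, in the ball of radius `d` around `fhat` in `H_θ`,
and in the ball on which `A` is Lipschitz. -/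
structure ForwardAssumption (L : H →ₗ.[ℝ] H) {κ : ℝ} (hK : KernelAssumption H' κ)
    (ν : Measure X) [IsProbabilityMeasure ν] (DA : Set H) (A : H → H') (fhat : H)
    (ℓA r p s α d θ : ℝ) (Q : Set H) : Prop where
  convex : Convex ℝ DA
  closed : IsClosed DA
  weak_continuous : ∀ (f : ℕ → H) (f₀ : H), (∀ n, f n ∈ DA) → f₀ ∈ DA →
    (∀ h : H, Tendsto (fun n => inner ℝ (f n) h) atTop (𝓝 (inner ℝ f₀ h))) →
    ∀ g : H', Tendsto (fun n => inner ℝ (A (f n)) g) atTop (𝓝 (inner ℝ (A f₀) g))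
  lipschitz_nonneg : 0 ≤ ℓA
  radius_pos : 0 < r
  lipschitz : ∀ f ∈ Metric.closedBall fhat r ∩ DA, ∀ g ∈ Metric.closedBall fhat r ∩ DA,
    ‖A f - A g‖ ≤ ℓA * ‖f - g‖
  d_pos : 0 < d
  θ_nonneg : 0 ≤ θ
  Q_subset_domain : Q ⊆ DA
  Q_subset_scaleBall : Q ⊆ scaleBall L θ fhat d
  Q_subset_closedBall : Q ⊆ Metric.closedBall fhat r
  stability : ∀ f ∈ Q, ‖negPow L p (f - fhat)‖ ≤ α * ‖inclusion hK ν (A f - A fhat)‖ ^ s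

/-- The Tikhonov functional
`(1/m) ∑ᵢ ‖A(f)(xᵢ) - yᵢ‖² + lam ‖L (f - fbar)‖²` for the sample `z = ((xᵢ, yᵢ))ᵢ`. -/
def tikhonov (L : H →ₗ.[ℝ] H) (A : H → H') (fbar : L.domain) {m : ℕ} (z : Fin m → X × Y)
    (lam : ℝ) (f : L.domain) : ℝ :=
  (1 / m) * ∑ i, ‖A f (z i).1 - (z i).2‖ ^ 2 + lam * ‖L (f - fbar)‖ ^ 2

/-- `f` is a Tikhonov estimator `f_{z,lam}`: a global minimizer of the Tikhonov functional over
`DA ∩ 𝒟(L)`. -/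
def IsTikhonovEstimator (L : H →ₗ.[ℝ] H) (DA : Set H) (A : H → H') (fbar : L.domain) {m : ℕ}
    (z : Fin m → X × Y) (lam : ℝ) (f : L.domain) : Prop :=
  (f : H) ∈ DA ∧ ∀ g : L.domain, (g : H) ∈ DA →
    tikhonov L A fbar z lam f ≤ tikhonov L A fbar z lam g

end Model

/-- The quantity `√(N / (m lam)) + R^{(p+1)/((p+q)-s(q-1))} lam^{s(q-1)/(2(p+q)-2s(q-1))}`. -/
def errorTerm (p q s N : ℝ) (m : ℕ) (lam R : ℝ) : ℝ :=
  √(N / (m * lam)) + R ^ ((p + 1) / ((p + q) - s * (q - 1))) *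
    lam ^ (s * (q - 1) / (2 * (p + q) - 2 * s * (q - 1)))

end

end HilbertScale

open HilbertScale

/-! Fractional powers of the inverse of `L`, a Bernstein inequality in Hilbert spaces, and the rates
of Tikhonov regularization. -/

namespace HilbertScale

noncomputable section


/-! ### Fractional powers by the binomial series -/

/-! Write g = f̂^R, f for the estimator, h = A f - A g, u = ‖I_ν h‖, w = ‖L(f - g)‖, d = d_A(R).
Since f minimizes the Tikhonov functional, its value at f is at most that at g. Expanding the
squares and replacing empirical averages by ν-integrals (`tikhonov_comparison`) bounds u² + λw² by
stochastic terms, plus 2ud, plus the penalty cross term 2λ|⟨L(f - g), L(g - f̄)⟩|.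

Cross term: L(g - f̄) = L^{-(q-1)}v with ‖v‖ ≤ R, so it is at most 2λR‖L^{-(q-1)}L(f - g)‖. The
moment inequality (`norm_fracPow_interpolation`) interpolates this norm between w and ‖L^{-(p+1)}L(f
- g)‖ = ‖f - g‖_{-p}. Conditional stability at f and at g bounds the latter by 2α(u + d)^s.

Stochastic terms: they are pairings ⟨h, ζ⟩, where ζ is a sum of noise vectors or the empirical
covariance error applied to h or to A g - A f̂. With T = T_ν, |⟨h, ζ⟩| ≤ (u² + λ‖h‖²)^{1/2}
‖(T+λ)^{-1/2}ζ‖ (`abs_inner_le_invSqrt`), and ‖h‖ is controlled by w through the Lipschitz bound.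
The weighted noise sum and the weighted covariance error, the latter taken in Hilbert-Schmidt norm,
obey a Bernstein inequality whose variance is governed by N(λ) (`exists_concentration_event`). The
event does not involve f, so it applies to the data-dependent h.

Conclusion: with P = √λ 𝓑 log(4/η), β = (q-1)/(p+1) and γ = 1 + β - sβ, the definition of 𝓑 and the
balancing equation give d ≤ P and Rλ^{(1+β)/2} ≤ P^γ. The inequality for (u, √λ w) then becomes
homogeneous in P and yields max(u, √λ w) ≤ C₀P (`max_le_of_balance`). A second interpolation, with
L^{-1}, gives the bound on ‖f - g‖.

Fractional powers are binomial series, so semigroup law, self-adjointness and interpolation need no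
spectral theorem. The same series provides (T+λ)^{-1/2}. -/

theorem succ_mul_choose_succ (a : ℝ) (k : ℕ) :
    (k + 1 : ℝ) * Ring.choose a (k + 1) = (a - k) * Ring.choose a k := by
  have := Ring.choose_smul_choose a (n := k + 1) (k := k) (by omega)
  simp only [Nat.choose_succ_self_right, add_tsub_cancel_left, Ring.choose_one_right,
    nsmul_eq_mul] at this
  push_cast at this
  rw [this]; ring

/-- With c_k the coefficients, a ≤ 1 and the recursion give a|c_k| = k|c_k| - (k+1)|c_{k+1}| for k ≥
1. The sum telescopes, and the terms with k ≥ 1 contribute at most 1, uniformly in a. -/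
theorem sum_abs_choose_le_two {a : ℝ} (ha : 0 < a) (ha1 : a ≤ 1) :
    ∑' k : ℕ, |Ring.choose a k| ≤ 2 := by
  have key : ∀ n : ℕ, (∑ i ∈ Finset.range n, |Ring.choose a (i + 1)|) * a
      = a - (n + 1) * |Ring.choose a (n + 1)| := by
    intro n
    induction n with
    | zero => simp [abs_of_pos ha]
    | succ n ih =>
      rw [Finset.sum_range_succ, add_mul, ih]
      have h := congrArg abs (succ_mul_choose_succ a (n + 1))
      have h0 : (0 : ℝ) ≤ n := n.cast_nonneg
      have h1 : (0 : ℝ) ≤ ((n + 1 : ℕ) : ℝ) + 1 := by positivity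
      have h2 : a - ((n + 1 : ℕ) : ℝ) ≤ 0 := by push_cast; linarith
      rw [abs_mul, abs_mul, abs_of_nonneg h1, abs_of_nonpos h2] at h
      push_cast at h ⊢
      linarith
  rw [(summable_abs_choose ha.le).tsum_eq_zero_add]
  have h1 : ∑' k : ℕ, |Ring.choose a (k + 1)| ≤ 1 := by
    refine Real.tsum_le_of_sum_range_le (fun _ => abs_nonneg _) fun n => ?_
    have : 0 ≤ (n + 1 : ℝ) * |Ring.choose a (n + 1)| := by positivity
    nlinarith [key n]
  simp only [Ring.choose_zero_right, abs_one]
  linarith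

section FracPow

variable {E : Type*} [NormedAddCommGroup E] [InnerProductSpace ℝ E] [CompleteSpace E]

/-- The power `C ^ a` of a bounded operator with `‖1 - C‖ ≤ 1`, for `a ≥ 0`, by its binomial
series. -/
def fracPow (C : E →L[ℝ] E) (a : ℝ) : E →L[ℝ] E :=
  ∑' k : ℕ, ((-1) ^ k * Ring.choose a k) • (1 - C) ^ k

theorem negPow_eq_fracPow (L : E →ₗ.[ℝ] E) (a : ℝ) :
    negPow L a = ‖invOp L‖ ^ a • fracPow (‖invOp L‖⁻¹ • invOp L) a := rfl

variable {C : E →L[ℝ] E}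

theorem norm_fracPow_term_le (hC : ‖1 - C‖ ≤ 1) (a : ℝ) (k : ℕ) :
    ‖((-1) ^ k * Ring.choose a k) • (1 - C) ^ k‖ ≤ |Ring.choose a k| := by
  rw [norm_smul, norm_mul, norm_pow, norm_neg, norm_one, one_pow, one_mul, Real.norm_eq_abs]
  refine mul_le_of_le_one_right (abs_nonneg _) ?_
  rcases k.eq_zero_or_pos with rfl | hk
  · rw [pow_zero]; exact ContinuousLinearMap.norm_id_le
  · exact (norm_pow_le' _ hk).trans (pow_le_one₀ (norm_nonneg _) hC)

theorem summable_norm_fracPow (hC : ‖1 - C‖ ≤ 1) {a : ℝ} (ha : 0 ≤ a) :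
    Summable fun k : ℕ => ‖((-1) ^ k * Ring.choose a k) • (1 - C) ^ k‖ :=
  (summable_abs_choose ha).of_nonneg_of_le (fun _ => norm_nonneg _) (norm_fracPow_term_le hC a)

theorem fracPow_zero : fracPow C 0 = 1 := by
  rw [fracPow, tsum_eq_single 0]
  · simp
  · intro k hk
    rw [Ring.choose_zero_pos ℝ (Nat.pos_of_ne_zero hk)]
    simp

theorem fracPow_one : fracPow C 1 = C := by
  rw [fracPow, tsum_eq_sum (s := Finset.range 2)]
  · simp [Finset.sum_range_succ]
  · intro k hk
    have hk : 1 < k := by simpa using hk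
    have := Ring.choose_natCast (R := ℝ) 1 k
    rw [Nat.choose_eq_zero_of_lt hk, Nat.cast_one, Nat.cast_zero] at this
    rw [this]; simp

/-- Cauchy product of the two absolutely convergent series, with the Vandermonde identity for the
coefficients. -/
theorem fracPow_add (hC : ‖1 - C‖ ≤ 1) {a b : ℝ} (ha : 0 ≤ a) (hb : 0 ≤ b) :
    fracPow C (a + b) = fracPow C a * fracPow C b := by
  unfold fracPow
  rw [tsum_mul_tsum_eq_tsum_sum_antidiagonal_of_summable_norm (summable_norm_fracPow hC ha)
    (summable_norm_fracPow hC hb)]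
  congr 1
  ext1 n
  rw [Ring.add_choose_eq n (Commute.all a b), Finset.mul_sum, Finset.sum_smul]
  refine Finset.sum_congr rfl fun ij hij => ?_
  rw [Finset.HasAntidiagonal.mem_antidiagonal] at hij
  rw [smul_mul_smul_comm, ← pow_add, hij, ← hij, pow_add]
  congr 1
  ring

theorem fracPow_mul_nat (hC : ‖1 - C‖ ≤ 1) {a : ℝ} (ha : 0 ≤ a) (n : ℕ) :
    fracPow C (n * a) = fracPow C a ^ n := by
  induction n with
  | zero => simp [fracPow_zero]
  | succ n ih =>
    rw [pow_succ, ← ih, ← fracPow_add hC (by positivity) ha]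
    congr 1; push_cast; ring

theorem norm_fracPow_le_two (hC : ‖1 - C‖ ≤ 1) {a : ℝ} (ha : 0 ≤ a) (ha1 : a ≤ 1) :
    ‖fracPow C a‖ ≤ 2 := by
  rcases ha.eq_or_lt with rfl | ha
  · rw [fracPow_zero]
    exact ContinuousLinearMap.norm_id_le.trans one_le_two
  · refine (norm_tsum_le_tsum_norm (summable_norm_fracPow hC ha.le)).trans ?_
    refine le_trans ?_ (sum_abs_choose_le_two ha ha1)
    exact (summable_norm_fracPow hC ha.le).tsum_le_tsum (norm_fracPow_term_le hC a)
      (summable_abs_choose ha.le)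

/-- Splitting the exponent into n + 1 equal parts of size at most 1 reduces to the uniform bound 2.
Local boundedness in the exponent replaces continuity in the convexity argument for the moment
inequality. -/
theorem exists_norm_fracPow_le (hC : ‖1 - C‖ ≤ 1) (b : ℝ) :
    ∃ K : ℝ, ∀ a, 0 ≤ a → a ≤ b → ‖fracPow C a‖ ≤ K := by
  obtain ⟨n, hn⟩ := exists_nat_ge b
  refine ⟨2 ^ (n + 1), fun a ha hab => ?_⟩
  have hpos : (0 : ℝ) < (n + 1 : ℕ) := by positivity
  have : a = (n + 1 : ℕ) * (a / (n + 1 : ℕ)) := by field_simp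
  rw [this, fracPow_mul_nat hC (by positivity)]
  refine (norm_pow_le' _ (Nat.succ_pos n)).trans ?_
  gcongr
  refine norm_fracPow_le_two hC (by positivity) ?_
  rw [div_le_one hpos]
  push_cast
  linarith

theorem commute_fracPow {D : E →L[ℝ] E} (h : Commute D C) (a : ℝ) : Commute D (fracPow C a) := by
  refine Commute.tsum_right _ fun k => ?_
  exact (((Commute.one_right D).sub_right h).pow_right k).smul_right _

theorem isSelfAdjoint_fracPow (h : IsSelfAdjoint C) (a : ℝ) :
    IsSelfAdjoint (fracPow C a) := by
  rw [IsSelfAdjoint, fracPow, tsum_star]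
  congr 1
  ext1 k
  rw [star_smul, star_trivial, (((IsSelfAdjoint.one _).sub h).pow k).star_eq]

/-- For an integer n ≥ a, the injective operator C^n factors as C^{n-a} C^a. -/
theorem injective_fracPow (hC : ‖1 - C‖ ≤ 1) (h : Function.Injective C) {a : ℝ} (ha : 0 ≤ a) :
    Function.Injective (fracPow C a) := by
  obtain ⟨n, hn⟩ := exists_nat_ge a
  have h1 : C ^ n = fracPow C (n - a) * fracPow C a := by
    rw [← fracPow_add hC (by linarith) ha, sub_add_cancel, ← mul_one (n : ℝ),
      fracPow_mul_nat hC zero_le_one, fracPow_one]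
  have h2 : Function.Injective (C ^ n) := by
    clear h1 hn
    induction n with
    | zero => exact Function.injective_id
    | succ n ih => rw [pow_succ]; exact ih.comp h
  rw [h1] at h2
  exact Function.Injective.of_comp (f := fracPow C (n - a)) h2

/-- Positivity of C at x - Cx, with ‖C‖ ≤ 1, gives ‖Cx‖² ≤ ⟨Cx, x⟩. Hence ‖x - Cx‖² ≤ ‖x‖² - ⟨Cx, x⟩
≤ ‖x‖². -/
theorem norm_one_sub_le_one (hC : C.IsPositive) (hC1 : ‖C‖ ≤ 1) : ‖1 - C‖ ≤ 1 := by
  refine ContinuousLinearMap.opNorm_le_bound _ zero_le_one fun x => ?_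
  rw [one_mul]
  have hs : ∀ x y : E, inner ℝ (C x) y = inner ℝ x (C y) := fun x y => hC.isSymmetric x y
  have hpos : ∀ y, 0 ≤ inner ℝ (C y) y := fun y => hC.inner_nonneg_left y
  have h1 : ‖C x‖ ^ 2 ≤ inner ℝ (C x) x := by
    have h2 : inner ℝ (C (C x)) (C x) ≤ ‖C x‖ ^ 2 := by
      refine (real_inner_le_norm _ _).trans ?_
      have := C.le_of_opNorm_le hC1 (C x)
      nlinarith [norm_nonneg (C x)]
    have h3 := hpos (x - C x)
    rw [map_sub, inner_sub_left, inner_sub_right, inner_sub_right, hs (C x) x,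
      real_inner_self_eq_norm_sq] at h3
    linarith
  refine abs_le_of_sq_le_sq' ?_ (norm_nonneg _) |>.2
  rw [sub_apply, one_apply_eq_self, norm_sub_sq_real,
    real_inner_comm]
  have := hpos x
  linarith

end FracPow

/-- A function bounded on `[0, b]` with `Φ 0 ≤ 1`, `Φ b ≤ 1` and midpoint log-convex is at most
`1`. -/
theorem le_one_of_midpoint_logConvex {Φ : ℝ → ℝ} {b K : ℝ}
    (h0 : Φ 0 ≤ 1) (hb : Φ b ≤ 1) (hnn : ∀ a, 0 ≤ a → a ≤ b → 0 ≤ Φ a)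
    (hK : ∀ a, 0 ≤ a → a ≤ b → Φ a ≤ K)
    (hmid : ∀ a c, 0 ≤ a → a ≤ b → 0 ≤ c → c ≤ b → Φ ((a + c) / 2) ^ 2 ≤ Φ a * Φ c)
    {a : ℝ} (ha : 0 ≤ a) (hab : a ≤ b) : Φ a ≤ 1 := by
  have hbb : 0 ≤ b := ha.trans hab
  let S : Set ℝ := Φ '' Set.Icc 0 b
  have hSne : S.Nonempty := ⟨Φ a, a, ⟨ha, hab⟩, rfl⟩
  have hSb : BddAbove S := ⟨K, by rintro _ ⟨x, hx, rfl⟩; exact hK x hx.1 hx.2⟩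
  have hle : ∀ x, 0 ≤ x → x ≤ b → Φ x ≤ sSup S := fun x h1 h2 => le_csSup hSb ⟨x, ⟨h1, h2⟩, rfl⟩
  have hM0 : 0 ≤ sSup S := (hnn a ha hab).trans (hle a ha hab)
  -- Each x is the midpoint of an endpoint, where Φ ≤ 1, and another point of [0, b]. Hence the
  -- supremum S₀ satisfies S₀² ≤ S₀.
  have hsq : ∀ x, 0 ≤ x → x ≤ b → Φ x ^ 2 ≤ sSup S := by
    intro x h1 h2
    rcases le_total x (b / 2) with h | h
    · have := hmid 0 (2 * x) le_rfl hbb (by linarith) (by linarith)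
      rw [show (0 + 2 * x) / 2 = x by ring] at this
      refine this.trans ?_
      have h3 := hle (2 * x) (by linarith) (by linarith)
      have h4 := hnn (2 * x) (by linarith) (by linarith)
      nlinarith
    · have := hmid (2 * x - b) b (by linarith) (by linarith) hbb le_rfl
      rw [show (2 * x - b + b) / 2 = x by ring] at this
      refine this.trans ?_
      have h3 := hle (2 * x - b) (by linarith) (by linarith)
      have h4 := hnn (2 * x - b) (by linarith) (by linarith)
      nlinarith
  have hM : sSup S ≤ √(sSup S) := by
    refine csSup_le hSne ?_
    rintro _ ⟨x, hx, rfl⟩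
    exact Real.le_sqrt_of_sq_le (hsq x hx.1 hx.2)
  have hM1 : sSup S ≤ 1 := by
    have h1 := Real.sq_sqrt hM0
    have h2 := Real.sqrt_nonneg (sSup S)
    by_contra hcon
    push Not at hcon
    have : 1 < √(sSup S) := by linarith
    nlinarith
  exact (hle a ha hab).trans hM1

section Moment

variable {E : Type*} [NormedAddCommGroup E] [InnerProductSpace ℝ E] [CompleteSpace E]
  {C : E →L[ℝ] E}

/-- The moment (interpolation) inequality `‖C ^ a w‖ ≤ ‖C ^ b w‖ ^ (a/b) ‖w‖ ^ (1 - a/b)`. -/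
theorem norm_fracPow_interpolation (hC : ‖1 - C‖ ≤ 1) (hs : IsSelfAdjoint C)
    (hi : Function.Injective C) {a b : ℝ} (ha : 0 ≤ a) (hb : 0 < b) (hab : a ≤ b) (w : E) :
    ‖fracPow C a w‖ ≤ ‖fracPow C b w‖ ^ (a / b) * ‖w‖ ^ (1 - a / b) := by
  rcases eq_or_ne w 0 with rfl | hw
  · simp only [map_zero, norm_zero]; positivity
  have hw0 : 0 < ‖w‖ := norm_pos_iff.2 hw
  have hbw : 0 < ‖fracPow C b w‖ := by
    rw [norm_pos_iff]
    intro h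
    exact hw (injective_fracPow hC hi hb.le (by rw [h, map_zero]))
  set β := ‖fracPow C b w‖ with hβ
  -- D is the log-affine interpolant of the two endpoint values. Dividing by it normalizes the
  -- endpoints to 1, and a positive lower bound for D keeps the quotient bounded.
  let D : ℝ → ℝ := fun x => β ^ (x / b) * ‖w‖ ^ (1 - x / b)
  have hD : ∀ x, 0 < D x := fun x => by positivity
  obtain ⟨K, hK⟩ := exists_norm_fracPow_le hC b
  have key : ‖fracPow C a w‖ / D a ≤ 1 := by
    have hDc : ∃ m : ℝ, 0 < m ∧ ∀ x, 0 ≤ x → x ≤ b → m ≤ D x := by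
      refine ⟨min β ‖w‖, lt_min hbw hw0, fun x h0 h1 => ?_⟩
      have hm : 0 < min β ‖w‖ := lt_min hbw hw0
      have e : min β ‖w‖ = (min β ‖w‖) ^ (x / b) * (min β ‖w‖) ^ (1 - x / b) := by
        rw [← Real.rpow_add hm]; simp
      rw [e]
      have h2 : 0 ≤ x / b := by positivity
      have h3 : 0 ≤ 1 - x / b := by rw [sub_nonneg, div_le_one hb]; exact h1
      have h4 : min β ‖w‖ ≤ β := min_le_left _ _
      have h5 : min β ‖w‖ ≤ ‖w‖ := min_le_right _ _
      have h6 := Real.rpow_le_rpow hm.le h4 h2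
      have h7 := Real.rpow_le_rpow hm.le h5 h3
      exact mul_le_mul h6 h7 (by positivity) (by positivity)
    obtain ⟨m, hm, hmD⟩ := hDc
    refine le_one_of_midpoint_logConvex (Φ := fun x => ‖fracPow C x w‖ / D x) (b := b)
      (K := K * ‖w‖ / m) ?_ ?_ ?_ ?_ ?_ ha hab
    · simp [D, fracPow_zero, hw0.ne']
    · simp only [D, div_self hb.ne', Real.rpow_one, sub_self, Real.rpow_zero, mul_one]
      exact (div_self hbw.ne').le
    · intro x _ _; exact div_nonneg (norm_nonneg _) (hD x).le
    · intro x h0 h1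
      have h2 := (fracPow C x).le_of_opNorm_le (hK x h0 h1) w
      exact div_le_div₀ ((norm_nonneg _).trans h2) h2 hm (hmD x h0 h1)
    · intro x y hx0 hxb hy0 hyb
      have h1 : D ((x + y) / 2) ^ 2 = D x * D y := by
        simp only [D]
        rw [mul_pow, ← Real.rpow_natCast, ← Real.rpow_natCast, ← Real.rpow_mul hbw.le,
          ← Real.rpow_mul hw0.le, mul_mul_mul_comm, ← Real.rpow_add hbw, ← Real.rpow_add hw0]
        congr 2 <;> push_cast <;> ring
      -- Midpoint log-convexity is Cauchy-Schwarz: by self-adjointness and the semigroup law the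
      -- left side is ⟨C^x w, C^y w⟩.
      have h2 : ‖fracPow C ((x + y) / 2) w‖ ^ 2 ≤ ‖fracPow C x w‖ * ‖fracPow C y w‖ := by
        have hz : 0 ≤ (x + y) / 2 := by linarith
        have e1 : inner ℝ (fracPow C ((x + y) / 2) w) (fracPow C ((x + y) / 2) w)
            = inner ℝ (fracPow C x w) (fracPow C y w) := by
          rw [← ContinuousLinearMap.adjoint_inner_right,
            ← ContinuousLinearMap.adjoint_inner_right (fracPow C x),
            (isSelfAdjoint_fracPow hs _).adjoint_eq, (isSelfAdjoint_fracPow hs x).adjoint_eq,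
            ← mul_apply_eq_comp, ← mul_apply_eq_comp,
            ← fracPow_add hC hz hz, ← fracPow_add hC hx0 hy0]
          congr 3; ring
        rw [← real_inner_self_eq_norm_sq, e1]
        exact real_inner_le_norm _ _
      rw [div_pow, h1, div_mul_div_comm]
      exact div_le_div_of_nonneg_right h2 (mul_pos (hD x) (hD y)).le
  exact (div_le_one (hD a)).1 key

end Moment

/-! ### The scale generated by `L` -/

section Generator

variable {H : Type*} [NormedAddCommGroup H] [InnerProductSpace ℝ H] [CompleteSpace H]
  {L : H →ₗ.[ℝ] H} {ℓL : ℝ}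

theorem IsScaleGenerator.mem_domain (hL : IsScaleGenerator L ℓL) (x : H) :
    invOp L x ∈ L.domain := (hL.isRightInverse_invOp x).choose

theorem IsScaleGenerator.apply_invOp (hL : IsScaleGenerator L ℓL) (x : H)
    (h : invOp L x ∈ L.domain) : L ⟨invOp L x, h⟩ = x := (hL.isRightInverse_invOp x).choose_spec

theorem IsScaleGenerator.injective (hL : IsScaleGenerator L ℓL) {f g : L.domain}
    (h : L f = L g) : f = g := by
  have h1 := hL.lower (f - g)
  rw [LinearPMap.map_sub, h, sub_self, norm_zero] at h1
  have h2 : ‖((f - g : L.domain) : H)‖ ≤ 0 := by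
    by_contra hh
    push Not at hh
    nlinarith [hL.lower_pos]
  have h3 : ((f - g : L.domain) : H) = 0 := by simpa using h2
  exact sub_eq_zero.1 (Subtype.ext h3)

theorem IsScaleGenerator.invOp_apply (hL : IsScaleGenerator L ℓL) (f : L.domain) :
    invOp L (L f) = f := by
  have h := hL.mem_domain (L f)
  have := hL.injective (hL.apply_invOp (L f) h)
  exact congrArg Subtype.val this

theorem IsScaleGenerator.invOp_injective (hL : IsScaleGenerator L ℓL) :
    Function.Injective (invOp L) := by
  intro x y h
  rw [← hL.apply_invOp x (hL.mem_domain x), ← hL.apply_invOp y (hL.mem_domain y)]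
  congr 2

theorem IsScaleGenerator.inner_symm (hL : IsScaleGenerator L ℓL) (f g : L.domain) :
    inner ℝ (L f) (g : H) = inner ℝ (f : H) (L g) := by
  have h := LinearPMap.adjoint_isFormalAdjoint hL.dense_domain
  rw [LinearPMap.isSelfAdjoint_def.1 hL.isSelfAdjoint] at h
  exact h f g

theorem IsScaleGenerator.isPositive_invOp (hL : IsScaleGenerator L ℓL) :
    (invOp L).IsPositive := by
  refine ⟨fun x y => ?_, fun x => ?_⟩
  · have h := hL.inner_symm ⟨_, hL.mem_domain x⟩ ⟨_, hL.mem_domain y⟩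
    rw [hL.apply_invOp, hL.apply_invOp] at h
    exact h.symm
  · have hx := hL.apply_invOp x (hL.mem_domain x)
    by_cases h0 : (⟨_, hL.mem_domain x⟩ : L.domain) = 0
    · have : invOp L x = 0 := congrArg Subtype.val h0
      simp [ContinuousLinearMap.reApplyInnerSelf, this]
    · have := hL.pos _ h0
      rw [hx, real_inner_comm] at this
      simpa [ContinuousLinearMap.reApplyInnerSelf] using this.le

theorem norm_one_sub_normalized_le {B : H →L[ℝ] H} (hB : B.IsPositive) :
    ‖1 - ‖B‖⁻¹ • B‖ ≤ 1 := by
  refine norm_one_sub_le_one ?_ ?_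
  · refine ⟨fun x y => ?_, fun x => ?_⟩
    · have := hB.isSymmetric x y
      simp only [ContinuousLinearMap.coe_coe] at this
      simp [inner_smul_left, inner_smul_right, this]
    · have := hB.inner_nonneg_left x
      simp only [ContinuousLinearMap.reApplyInnerSelf, smul_apply,
        inner_smul_left, RCLike.re_to_real, conj_trivial]
      positivity
  · rw [norm_smul, norm_inv, norm_norm]
    exact inv_mul_le_one

theorem IsScaleGenerator.norm_one_sub_le (hL : IsScaleGenerator L ℓL) : ‖1 - ‖invOp L‖⁻¹ • invOp L‖ ≤ 1 :=
  norm_one_sub_normalized_le hL.isPositive_invOp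

theorem IsScaleGenerator.isSelfAdjoint_negPow (hL : IsScaleGenerator L ℓL) (a : ℝ) :
    IsSelfAdjoint (negPow L a) := by
  rw [negPow_eq_fracPow]
  refine IsSelfAdjoint.smul (IsSelfAdjoint.all _) (isSelfAdjoint_fracPow ?_ a)
  exact IsSelfAdjoint.smul (IsSelfAdjoint.all _) hL.isPositive_invOp.isSelfAdjoint

theorem IsScaleGenerator.norm_invOp_pos [Nontrivial H] (hL : IsScaleGenerator L ℓL) :
    0 < ‖invOp L‖ := by
  rw [norm_pos_iff]
  intro h
  obtain ⟨x, y, hxy⟩ := exists_pair_ne H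
  exact hxy (hL.invOp_injective (by simp [h]))

theorem IsScaleGenerator.negPow_add (hL : IsScaleGenerator L ℓL) {a b : ℝ} (ha : 0 ≤ a)
    (hb : 0 ≤ b) : negPow L (a + b) = negPow L a * negPow L b := by
  -- On the trivial space ‖L⁻¹‖ = 0, while the exponent law for real powers needs a positive base.
  rcases subsingleton_or_nontrivial H with hH | hH
  · ext x
    exact Subsingleton.elim _ _
  simp only [negPow_eq_fracPow]
  rw [fracPow_add hL.norm_one_sub_le ha hb, Real.rpow_add hL.norm_invOp_pos, smul_mul_smul_comm]

/-- The normalizing factors match, since ‖L⁻¹‖^a = (‖L⁻¹‖^b)^{a/b}. -/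
theorem IsScaleGenerator.norm_negPow_interpolation (hL : IsScaleGenerator L ℓL) {a b : ℝ} (ha : 0 ≤ a) (hb : 0 < b)
    (hab : a ≤ b) (w : H) :
    ‖negPow L a w‖ ≤ ‖negPow L b w‖ ^ (a / b) * ‖w‖ ^ (1 - a / b) := by
  rcases subsingleton_or_nontrivial H with hH | hH
  · rw [Subsingleton.elim (negPow L a w) 0, norm_zero]
    positivity
  have hpos := hL.norm_invOp_pos
  simp only [negPow_eq_fracPow, smul_apply, norm_smul]
  have h1 := norm_fracPow_interpolation hL.norm_one_sub_le
    (IsSelfAdjoint.smul (IsSelfAdjoint.all (‖invOp L‖⁻¹)) hL.isPositive_invOp.isSelfAdjoint)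
    (fun x y h => hL.invOp_injective (by simpa [hpos.ne'] using h)) ha hb hab w
  rw [Real.norm_of_nonneg (by positivity), Real.norm_of_nonneg (by positivity),
    Real.mul_rpow (by positivity) (norm_nonneg _), ← Real.rpow_mul hpos.le,
    mul_div_cancel₀ a hb.ne', mul_assoc]
  gcongr

end Generator

/-! ### A Bernstein inequality in Hilbert spaces -/

theorem hasSum_exp_sub (u : ℝ) :
    HasSum (fun k : ℕ => u ^ (k + 2) / (k + 2).factorial) (Real.exp u - u - 1) := by
  have h := NormedSpace.expSeries_div_hasSum_exp (𝔸 := ℝ) u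
  rw [← Real.exp_eq_exp_ℝ] at h
  have := (hasSum_nat_add_iff' 2).2 h
  simpa [Finset.sum_range_succ, sub_sub, add_comm] using this

theorem exp_sub_nonneg (u : ℝ) : 0 ≤ Real.exp u - u - 1 := by
  linarith [Real.add_one_le_exp u]

/-- The power series of e^u - u - 1 starts at u², so scaling the argument down by τ gains τ². This
transfers the noise condition from scale M to smaller exponential parameters. -/
theorem exp_sub_mul_le {τ u : ℝ} (hτ : 0 ≤ τ) (hτ1 : τ ≤ 1) (hu : 0 ≤ u) :
    Real.exp (τ * u) - τ * u - 1 ≤ τ ^ 2 * (Real.exp u - u - 1) := by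
  refine hasSum_le (fun k => ?_) (hasSum_exp_sub (τ * u)) ((hasSum_exp_sub u).mul_left (τ ^ 2))
  rw [mul_div_assoc']
  refine div_le_div_of_nonneg_right ?_ (by positivity)
  rw [mul_pow]
  have : τ ^ (k + 2) ≤ τ ^ 2 := pow_le_pow_of_le_one hτ hτ1 (by omega)
  gcongr

theorem exp_sub_le_sq {u : ℝ} (hu : 0 ≤ u) (hu1 : u ≤ 1) : Real.exp u - u - 1 ≤ u ^ 2 := by
  have h := exp_sub_mul_le hu hu1 zero_le_one
  rw [mul_one] at h
  nlinarith [Real.exp_one_lt_d9, sq_nonneg u]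

theorem exp_sub_mono {u v : ℝ} (hu : 0 ≤ u) (huv : u ≤ v) :
    Real.exp u - u - 1 ≤ Real.exp v - v - 1 := by
  refine hasSum_le (fun k => ?_) (hasSum_exp_sub u) (hasSum_exp_sub v)
  gcongr

/-- cosh √x = ∑ xⁿ/(2n)! has nonnegative coefficients, so convexity holds term by term. -/
theorem cosh_sqrt_convex {s t θ : ℝ} (hs : 0 ≤ s) (ht : 0 ≤ t) (hθ : 0 ≤ θ) (hθ1 : θ ≤ 1) :
    Real.cosh √((1 - θ) * s + θ * t) ≤ (1 - θ) * Real.cosh √s + θ * Real.cosh √t := by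
  have key : ∀ x : ℝ, 0 ≤ x →
      HasSum (fun n : ℕ => x ^ n / ((2 * n).factorial : ℝ)) (Real.cosh √x) := by
    intro x hx
    have := Real.hasSum_cosh √x
    simpa only [pow_mul, Real.sq_sqrt hx] using this
  have h1 : 0 ≤ 1 - θ := by linarith
  refine hasSum_le (fun n => ?_) (key _ (by positivity))
    (((key s hs).mul_left (1 - θ)).add ((key t ht).mul_left θ))
  rw [mul_div_assoc', mul_div_assoc', ← add_div]
  refine div_le_div_of_nonneg_right ?_ (by positivity)
  have := (convexOn_pow (𝕜 := ℝ) n).2 hs ht h1 hθ (by ring)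
  simpa using this

section Cosh

variable {V : Type*} [NormedAddCommGroup V] [InnerProductSpace ℝ V]

/-- A second-order expansion of cosh‖·‖, linear in v up to a Bernstein remainder. With a = ‖x‖, b =
‖v‖, the square ‖x+v‖² is a convex combination of (a-b)² and (a+b)², with weight θ given by ⟨x, v⟩ =
ab(2θ-1). Convexity of cosh √ bounds the left side by cosh a cosh b + (2θ-1) sinh a sinh b, and sinh
a ≤ cosh a absorbs the term in sinh b - b. -/
theorem cosh_norm_add_le (x v : V) :
    Real.cosh ‖x + v‖ ≤ Real.cosh ‖x‖ + Real.sinh ‖x‖ / ‖x‖ * inner ℝ x v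
      + Real.cosh ‖x‖ * (Real.exp ‖v‖ - ‖v‖ - 1) := by
  set a := ‖x‖ with ha
  set b := ‖v‖ with hb
  have ha0 : 0 ≤ a := norm_nonneg _
  have hb0 : 0 ≤ b := norm_nonneg _
  have hip := abs_real_inner_le_norm x v
  rw [abs_le, ← ha, ← hb] at hip
  obtain ⟨θ, hθ0, hθ1, hθ⟩ : ∃ θ : ℝ, 0 ≤ θ ∧ θ ≤ 1 ∧ inner ℝ x v = a * b * (2 * θ - 1) := by
    rcases (mul_nonneg ha0 hb0).eq_or_lt with h | h
    · refine ⟨1 / 2, by norm_num, by norm_num, ?_⟩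
      linarith
    · refine ⟨(inner ℝ x v + a * b) / (2 * (a * b)), ?_, ?_, ?_⟩
      · exact div_nonneg (by linarith) (by linarith)
      · rw [div_le_one (by linarith)]; linarith
      · generalize a * b = c at h
        field_simp
        ring
  have hn : ‖x + v‖ = √((1 - θ) * (a - b) ^ 2 + θ * (a + b) ^ 2) := by
    rw [← Real.sqrt_sq (norm_nonneg (x + v)), norm_add_sq_real, hθ]
    congr 1
    rw [← ha, ← hb]; ring
  have h1 := cosh_sqrt_convex (sq_nonneg (a - b)) (sq_nonneg (a + b)) hθ0 hθ1
  rw [← hn, Real.sqrt_sq_eq_abs, Real.sqrt_sq_eq_abs, Real.cosh_abs, Real.cosh_abs, Real.cosh_sub,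
    Real.cosh_add] at h1
  have h2 : Real.sinh a / a * inner ℝ x v = (2 * θ - 1) * (b * Real.sinh a) := by
    rcases ha0.eq_or_lt with h | h
    · rw [← h]; simp
    · rw [hθ]; field_simp
  rw [h2]
  have h3 : 0 ≤ Real.sinh b - b := by linarith [Real.self_le_sinh_iff.2 hb0]
  have h4 : 0 ≤ Real.sinh a := Real.sinh_nonneg_iff.2 ha0
  have h5 : Real.sinh a ≤ Real.cosh a := (Real.sinh_lt_cosh a).le
  have h6 : Real.exp b = Real.cosh b + Real.sinh b := (Real.cosh_add_sinh b).symm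
  rw [h6]
  have h7 : (2 * θ - 1) * (Real.sinh a * (Real.sinh b - b)) ≤ Real.cosh a * (Real.sinh b - b) := by
    have : (2 * θ - 1) * Real.sinh a ≤ Real.cosh a := by nlinarith
    nlinarith
  linarith

end Cosh

section Bernstein

variable {V : Type*} [NormedAddCommGroup V] [InnerProductSpace ℝ V]
  {Ω : Type*} [MeasurableSpace Ω] {μ : Measure Ω} [IsProbabilityMeasure μ] {ξ : Ω → V} {a : ℝ}

/-- The linear term of `cosh_norm_add_le` integrates to zero, leaving cosh‖x‖(1 + a) ≤ cosh‖x‖ e^a.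
-/
theorem lintegral_cosh_norm_add_le (hξ : StronglyMeasurable ξ) (hint : Integrable ξ μ)
    (hmean : ∀ x : V, ∫ ω, inner ℝ x (ξ ω) ∂μ = 0) (ha : 0 ≤ a)
    (hexp : ∫⁻ ω, ENNReal.ofReal (Real.exp ‖ξ ω‖ - ‖ξ ω‖ - 1) ∂μ ≤ ENNReal.ofReal a) (x : V) :
    ∫⁻ ω, ENNReal.ofReal (Real.cosh ‖x + ξ ω‖) ∂μ
      ≤ ENNReal.ofReal (Real.cosh ‖x‖ * Real.exp a) := by
  have hmeas : AEStronglyMeasurable (fun ω => Real.exp ‖ξ ω‖ - ‖ξ ω‖ - 1) μ :=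
    (Continuous.comp_stronglyMeasurable (g := fun v : V => Real.exp ‖v‖ - ‖v‖ - 1)
      (by fun_prop) hξ).aestronglyMeasurable
  have hψ : Integrable (fun ω => Real.exp ‖ξ ω‖ - ‖ξ ω‖ - 1) μ := by
    refine ⟨hmeas, ?_⟩
    rw [hasFiniteIntegral_iff_ofReal (Eventually.of_forall fun ω => exp_sub_nonneg _)]
    exact hexp.trans_lt ENNReal.ofReal_lt_top
  have hψa : ∫ ω, (Real.exp ‖ξ ω‖ - ‖ξ ω‖ - 1) ∂μ ≤ a := by
    rw [integral_eq_lintegral_of_nonneg_ae (Eventually.of_forall fun ω => exp_sub_nonneg _) hmeas]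
    exact ENNReal.toReal_le_of_le_ofReal ha hexp
  have hin : Integrable (fun ω => inner ℝ x (ξ ω)) μ := hint.const_inner x
  refine (lintegral_mono fun ω => ENNReal.ofReal_le_ofReal (cosh_norm_add_le x (ξ ω))).trans ?_
  have hI : Integrable (fun ω => Real.cosh ‖x‖ + Real.sinh ‖x‖ / ‖x‖ * inner ℝ x (ξ ω)
      + Real.cosh ‖x‖ * (Real.exp ‖ξ ω‖ - ‖ξ ω‖ - 1)) μ :=
    ((integrable_const _).add (hin.const_mul _)).add (hψ.const_mul _)
  rw [← ofReal_integral_eq_lintegral_ofReal hI (Eventually.of_forall fun ω =>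
    (Real.cosh_pos _).le.trans (cosh_norm_add_le x (ξ ω)))]
  refine ENNReal.ofReal_le_ofReal ?_
  have hI1 : Integrable (fun ω => Real.cosh ‖x‖ + Real.sinh ‖x‖ / ‖x‖ * inner ℝ x (ξ ω)) μ :=
    (integrable_const _).add (hin.const_mul _)
  rw [integral_add hI1 (hψ.const_mul _),
    integral_add (integrable_const _) (hin.const_mul _), integral_const_mul, integral_const_mul,
    hmean, integral_const]
  simp only [probReal_univ, one_smul, mul_zero, add_zero]
  have h1 := Real.cosh_pos ‖x‖
  have h2 := Real.add_one_le_exp a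
  nlinarith

/-- One coordinate is split off by Tonelli. The arbitrary starting point x lets the induction
hypothesis be applied at x + ξ(ω). -/
theorem lintegral_cosh_norm_sum_le (hξ : StronglyMeasurable ξ) (hint : Integrable ξ μ)
    (hmean : ∀ x : V, ∫ ω, inner ℝ x (ξ ω) ∂μ = 0) (ha : 0 ≤ a)
    (hexp : ∫⁻ ω, ENNReal.ofReal (Real.exp ‖ξ ω‖ - ‖ξ ω‖ - 1) ∂μ ≤ ENNReal.ofReal a)
    (m : ℕ) (x : V) :
    ∫⁻ z, ENNReal.ofReal (Real.cosh ‖x + ∑ i, ξ (z i)‖) ∂(Measure.pi fun _ : Fin m => μ)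
      ≤ ENNReal.ofReal (Real.cosh ‖x‖ * Real.exp (m * a)) := by
  induction m generalizing x with
  | zero => simp
  | succ m ih =>
    have hmp := measurePreserving_piFinSuccAbove (fun _ : Fin (m + 1) => μ) 0
    have hsm : Measurable fun p : Ω × (Fin m → Ω) =>
        ENNReal.ofReal (Real.cosh ‖x + (ξ p.1 + ∑ i, ξ (p.2 i))‖) := by
      have h1 : StronglyMeasurable fun p : Ω × (Fin m → Ω) => x + (ξ p.1 + ∑ i, ξ (p.2 i)) := by
        refine stronglyMeasurable_const.add ((hξ.comp_measurable measurable_fst).add ?_)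
        exact Finset.stronglyMeasurable_fun_sum _ fun i _ => hξ.comp_measurable (by fun_prop)
      exact ENNReal.measurable_ofReal.comp
        ((Real.continuous_cosh.comp_stronglyMeasurable h1.norm).measurable)
    have e : ∫⁻ z, ENNReal.ofReal (Real.cosh ‖x + ∑ i, ξ (z i)‖)
          ∂(Measure.pi fun _ : Fin (m + 1) => μ)
        = ∫⁻ p, ENNReal.ofReal (Real.cosh ‖x + (ξ p.1 + ∑ i, ξ (p.2 i))‖)
          ∂(μ.prod (Measure.pi fun _ : Fin m => μ)) := by
      rw [← hmp.lintegral_comp hsm]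
      refine lintegral_congr fun z => ?_
      rw [Fin.sum_univ_succ]
      rfl
    rw [e, lintegral_prod _ hsm.aemeasurable]
    calc _ ≤ ∫⁻ ω, ENNReal.ofReal (Real.cosh ‖x + ξ ω‖ * Real.exp (m * a)) ∂μ := by
          refine lintegral_mono fun ω => ?_
          simp only [← add_assoc]
          exact ih (x + ξ ω)
      _ = (∫⁻ ω, ENNReal.ofReal (Real.cosh ‖x + ξ ω‖) ∂μ) * ENNReal.ofReal (Real.exp (m * a)) := by
          rw [← lintegral_mul_const']
          · exact lintegral_congr fun ω => ENNReal.ofReal_mul (Real.cosh_pos _).le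
          · exact ENNReal.ofReal_ne_top
      _ ≤ ENNReal.ofReal (Real.cosh ‖x‖ * Real.exp a) * ENNReal.ofReal (Real.exp (m * a)) := by
          gcongr
          exact lintegral_cosh_norm_add_le hξ hint hmean ha hexp x
      _ = _ := by
          rw [← ENNReal.ofReal_mul (mul_nonneg (Real.cosh_pos _).le (Real.exp_pos _).le), mul_assoc,
            ← Real.exp_add]
          congr 3
          push_cast; ring

/-- Exponential tail bound for sums of independent centred random vectors. -/
theorem measureReal_norm_sum_le_ge (hξ : StronglyMeasurable ξ) (hint : Integrable ξ μ)
    (hmean : ∀ x : V, ∫ ω, inner ℝ x (ξ ω) ∂μ = 0) (ha : 0 ≤ a) {t : ℝ} (ht : 0 < t)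
    (hexp : ∫⁻ ω, ENNReal.ofReal (Real.exp (t * ‖ξ ω‖) - t * ‖ξ ω‖ - 1) ∂μ ≤ ENNReal.ofReal a)
    (m : ℕ) (r : ℝ) :
    MeasurableSet {z : Fin m → Ω | ‖∑ i, ξ (z i)‖ ≤ r} ∧
    1 - 2 * Real.exp (m * a - t * r)
      ≤ (Measure.pi fun _ : Fin m => μ).real {z | ‖∑ i, ξ (z i)‖ ≤ r} := by
  have hsum : StronglyMeasurable fun z : Fin m → Ω => ∑ i, ξ (z i) :=
    Finset.stronglyMeasurable_fun_sum _ fun i _ => hξ.comp_measurable (by fun_prop)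
  have hS : MeasurableSet {z : Fin m → Ω | ‖∑ i, ξ (z i)‖ ≤ r} :=
    hsum.norm.measurable measurableSet_Iic
  refine ⟨hS, ?_⟩
  have hnorm : ∀ v : V, ‖t • v‖ = t * ‖v‖ := fun v => by rw [norm_smul, Real.norm_of_nonneg ht.le]
  have h1 := lintegral_cosh_norm_sum_le (ξ := fun ω => t • ξ ω) (hξ.const_smul t) (hint.smul t)
    (fun x => by simp only [inner_smul_right, integral_const_mul, hmean, mul_zero]) ha
    (by simpa only [hnorm] using hexp) m 0
  simp only [zero_add, norm_zero, Real.cosh_zero, one_mul, ← Finset.smul_sum, hnorm] at h1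
  set P := Measure.pi fun _ : Fin m => μ
  -- Markov's inequality for cosh(t‖·‖); the factor 2 comes from cosh x ≥ eˣ/2.
  have h2 : P.real {z | ‖∑ i, ξ (z i)‖ ≤ r}ᶜ ≤ 2 * Real.exp (m * a - t * r) := by
    have h3 : ENNReal.ofReal (Real.exp (t * r) / 2) * P {z | ‖∑ i, ξ (z i)‖ ≤ r}ᶜ
        ≤ ENNReal.ofReal (Real.exp (m * a)) := by
      refine le_trans ?_ h1
      refine le_trans ?_ (mul_meas_ge_le_lintegral₀ ?_ (ENNReal.ofReal (Real.exp (t * r) / 2)))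
      · gcongr
        intro z hz
        simp only [Set.mem_compl_iff, Set.mem_ofPred_eq, not_le] at hz ⊢
        refine ENNReal.ofReal_le_ofReal ?_
        rw [Real.cosh_eq]
        have : Real.exp (t * r) ≤ Real.exp (t * ‖∑ i, ξ (z i)‖) := by gcongr
        have := Real.exp_pos (-(t * ‖∑ i, ξ (z i)‖))
        linarith
      · exact (ENNReal.measurable_ofReal.comp (Real.continuous_cosh.comp_stronglyMeasurable
          (hsum.norm.const_mul t)).measurable).aemeasurable
    have h4 := ENNReal.toReal_mono ENNReal.ofReal_ne_top h3
    rw [ENNReal.toReal_mul, ENNReal.toReal_ofReal (by positivity),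
      ENNReal.toReal_ofReal (by positivity)] at h4
    rw [Real.exp_sub, mul_div_assoc', le_div_iff₀ (Real.exp_pos _)]
    rw [Measure.real]
    linarith
  rw [probReal_compl_eq_one_sub hS] at h2
  linarith

end Bernstein

/-! ### Resolvents of positive operators and their square roots -/

section Resolvent

variable {E : Type*} [NormedAddCommGroup E] [InnerProductSpace ℝ E] [CompleteSpace E]
  {T : E →L[ℝ] E} {lam : ℝ}

theorem isUnit_add_smul_one (hT : T.IsPositive) (hlam : 0 < lam) : IsUnit (T + lam • 1) := by
  refine ContinuousLinearMap.isUnit_of_forall_le_norm_inner_map _ (c := ⟨lam, hlam.le⟩) hlam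
    fun x => ?_
  refine le_trans ?_ (le_abs_self _)
  have := hT.inner_nonneg_left x
  simp only [add_apply, smul_apply, one_apply_eq_self, inner_add_left, real_inner_smul_left,
    real_inner_self_eq_norm_sq]
  change ‖x‖ ^ 2 * lam ≤ _
  linarith

/-- The resolvent `(T + lam)⁻¹`. -/
def resolvent (T : E →L[ℝ] E) (lam : ℝ) : E →L[ℝ] E := Ring.inverse (T + lam • 1)

theorem resolvent_mul (hT : T.IsPositive) (hlam : 0 < lam) :
    resolvent T lam * (T + lam • 1) = 1 :=
  Ring.inverse_mul_cancel _ (isUnit_add_smul_one hT hlam)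

theorem mul_resolvent (hT : T.IsPositive) (hlam : 0 < lam) :
    (T + lam • 1) * resolvent T lam = 1 :=
  Ring.mul_inverse_cancel _ (isUnit_add_smul_one hT hlam)

theorem commute_resolvent (T : E →L[ℝ] E) (lam : ℝ) : Commute T (resolvent T lam) := by
  have hc : Commute T (T + lam • 1) :=
    (Commute.refl T).add_right ((Commute.one_right T).smul_right lam)
  by_cases h : IsUnit (T + lam • 1)
  · obtain ⟨u, hu⟩ := h
    rw [resolvent, ← hu, Ring.inverse_unit]
    rw [← hu] at hc
    exact hc.units_inv_right
  · rw [resolvent, Ring.inverse_non_unit _ h]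
    exact Commute.zero_right T

theorem inner_resolvent_eq (hT : T.IsPositive) (hlam : 0 < lam) (x y : E) :
    inner ℝ (resolvent T lam x) y
      = inner ℝ (T (resolvent T lam x)) (resolvent T lam y)
        + lam * inner ℝ (resolvent T lam x) (resolvent T lam y) := by
  have h := congrArg (fun A : E →L[ℝ] E => A y) (mul_resolvent hT hlam)
  simp only [mul_apply_eq_comp, add_apply, smul_apply, one_apply_eq_self] at h
  have hs := hT.isSymmetric (resolvent T lam x) (resolvent T lam y)
  simp only [ContinuousLinearMap.coe_coe] at hs
  rw [hs, ← real_inner_smul_right, ← inner_add_right, h]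

theorem isPositive_resolvent (hT : T.IsPositive) (hlam : 0 < lam) :
    (resolvent T lam).IsPositive := by
  refine ⟨fun x y => ?_, fun x => ?_⟩
  · have h1 := inner_resolvent_eq hT hlam x y
    have h2 := inner_resolvent_eq hT hlam y x
    have hs := hT.isSymmetric (resolvent T lam x) (resolvent T lam y)
    simp only [ContinuousLinearMap.coe_coe] at hs ⊢
    rw [h1, hs, real_inner_comm, real_inner_comm (resolvent T lam y), ← h2, real_inner_comm]
  · have h1 := inner_resolvent_eq hT hlam x x
    have h2 := hT.inner_nonneg_left (resolvent T lam x)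
    simp only [ContinuousLinearMap.reApplyInnerSelf, RCLike.re_to_real]
    rw [h1, real_inner_self_eq_norm_sq]
    positivity

theorem norm_resolvent_le (hT : T.IsPositive) (hlam : 0 < lam) : ‖resolvent T lam‖ ≤ lam⁻¹ := by
  refine ContinuousLinearMap.opNorm_le_bound _ (by positivity) fun x => ?_
  have h1 := inner_resolvent_eq hT hlam x x
  have h2 := hT.inner_nonneg_left (resolvent T lam x)
  have h3 := real_inner_le_norm (resolvent T lam x) x
  rw [real_inner_self_eq_norm_sq] at h1
  rw [inv_mul_eq_div, le_div_iff₀ hlam]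
  rcases (norm_nonneg (resolvent T lam x)).eq_or_lt with h | h
  · rw [← h]; simp
  · nlinarith

/-- The operator `(T + lam)^{-1/2}`. -/
def invSqrt (T : E →L[ℝ] E) (lam : ℝ) : E →L[ℝ] E :=
  (√lam)⁻¹ • fracPow (lam • resolvent T lam) (1 / 2)

/-- Admits λ(T+λ)⁻¹, which lies between 0 and 1, to the binomial series. This is why `invSqrt` takes
the root of this operator and divides by √λ. -/
theorem norm_one_sub_smul_resolvent_le (hT : T.IsPositive) (hlam : 0 < lam) :
    ‖1 - lam • resolvent T lam‖ ≤ 1 := by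
  refine norm_one_sub_le_one ?_ ?_
  · exact (isPositive_resolvent hT hlam).smul_of_nonneg hlam.le
  · rw [norm_smul, Real.norm_of_nonneg hlam.le]
    have := norm_resolvent_le hT hlam
    calc _ ≤ lam * lam⁻¹ := by gcongr
      _ = 1 := mul_inv_cancel₀ hlam.ne'

theorem isSelfAdjoint_invSqrt (hT : T.IsPositive) (hlam : 0 < lam) :
    IsSelfAdjoint (invSqrt T lam) :=
  IsSelfAdjoint.smul (IsSelfAdjoint.all _) (isSelfAdjoint_fracPow
    (IsSelfAdjoint.smul (IsSelfAdjoint.all _) (isPositive_resolvent hT hlam).isSelfAdjoint) _)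

theorem invSqrt_mul_invSqrt (hT : T.IsPositive) (hlam : 0 < lam) :
    invSqrt T lam * invSqrt T lam = resolvent T lam := by
  rw [invSqrt, smul_mul_smul_comm, ← fracPow_add (norm_one_sub_smul_resolvent_le hT hlam)
    (by norm_num) (by norm_num), add_halves, fracPow_one, smul_smul, ← mul_inv,
    Real.mul_self_sqrt hlam.le, inv_mul_cancel₀ hlam.ne', one_smul]

theorem commute_invSqrt (T : E →L[ℝ] E) (lam : ℝ) : Commute T (invSqrt T lam) :=
  (commute_fracPow ((commute_resolvent T lam).smul_right lam) _).smul_right _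

theorem inner_invSqrt (hT : T.IsPositive) (hlam : 0 < lam) (x y : E) :
    inner ℝ (invSqrt T lam x) y = inner ℝ x (invSqrt T lam y) := by
  rw [← ContinuousLinearMap.adjoint_inner_right, (isSelfAdjoint_invSqrt hT hlam).adjoint_eq]

theorem norm_invSqrt_sq_le (hT : T.IsPositive) (hlam : 0 < lam) :
    ‖invSqrt T lam‖ ^ 2 ≤ lam⁻¹ := by
  have h := CStarRing.norm_star_mul_self (x := invSqrt T lam)
  rw [(isSelfAdjoint_invSqrt hT hlam).star_eq, invSqrt_mul_invSqrt hT hlam] at h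
  rw [sq, ← h]
  exact norm_resolvent_le hT hlam

/-- With G = (T+λ)^{-1/2}, the operator F = (T+λ)G is self-adjoint, F² = T+λ and FG = 1. Hence ⟨h,
ζ⟩ = ⟨Fh, Gζ⟩, and ‖Fh‖² is the quantity under the root. -/
theorem abs_inner_le_invSqrt (hT : T.IsPositive) (hlam : 0 < lam) (h ζ : E) :
    |inner ℝ h ζ| ≤ √(inner ℝ (T h) h + lam * ‖h‖ ^ 2) * ‖invSqrt T lam ζ‖ := by
  set G := invSqrt T lam with hG
  have hc : Commute (T + lam • 1) G := (commute_invSqrt T lam).add_left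
    ((Commute.one_left G).smul_left lam)
  have hGG : (T + lam • 1) * (G * G) = 1 := by
    rw [invSqrt_mul_invSqrt hT hlam, mul_resolvent hT hlam]
  set F := (T + lam • 1) * G with hF
  have hFs : IsSelfAdjoint F := by
    refine (IsSelfAdjoint.commute_iff ?_ (isSelfAdjoint_invSqrt hT hlam)).1 hc
    exact hT.isSelfAdjoint.add (IsSelfAdjoint.smul (IsSelfAdjoint.all _) (IsSelfAdjoint.one _))
  have hFG : F * G = 1 := by rw [hF, mul_assoc, hGG]
  have hFF : F * F = T + lam • 1 := by
    calc F * F = (T + lam • 1) * ((T + lam • 1) * (G * G)) := by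
          rw [hF, mul_assoc, ← mul_assoc G, ← hc.eq, mul_assoc]
      _ = T + lam • 1 := by rw [hGG, mul_one]
  have hζ : ζ = F (G ζ) := by
    rw [← mul_apply_eq_comp, hFG, one_apply_eq_self]
  have hFh : ‖F h‖ = √(inner ℝ (T h) h + lam * ‖h‖ ^ 2) := by
    rw [← Real.sqrt_sq (norm_nonneg (F h)), ← real_inner_self_eq_norm_sq,
      ← ContinuousLinearMap.adjoint_inner_left, hFs.adjoint_eq, ← mul_apply_eq_comp, hFF]
    simp [inner_add_left, real_inner_smul_left]
  rw [← hFh]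
  conv_lhs => rw [hζ, ← ContinuousLinearMap.adjoint_inner_left, hFs.adjoint_eq]
  exact abs_real_inner_le_norm _ _

theorem inner_resolvent_mul (hT : T.IsPositive) (hlam : 0 < lam) (x : E) :
    inner ℝ ((resolvent T lam * T) x) x = inner ℝ (T (invSqrt T lam x)) (invSqrt T lam x) := by
  rw [← inner_invSqrt hT hlam, ← mul_apply_eq_comp, ← mul_apply_eq_comp, mul_assoc,
    (commute_invSqrt T lam).eq, ← mul_assoc, invSqrt_mul_invSqrt hT hlam]

/-- Operator form of t/(t+1) ≤ t/(t+λ) ≤ λ⁻¹t/(t+1). Substituting x = (T+1)(T+λ)w turns all terms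
into polynomials in T at w. The two differences are then (1-λ)⟨Tw, x⟩ and (1-λ)⟨T²w, x⟩, both
nonnegative. -/
theorem resolvent_mul_bounds (hT : T.IsPositive) (hlam : 0 < lam) (hlam1 : lam ≤ 1) (x : E) :
    inner ℝ ((resolvent T 1 * T) x) x ≤ inner ℝ ((resolvent T lam * T) x) x ∧
    lam * inner ℝ ((resolvent T lam * T) x) x ≤ inner ℝ ((resolvent T 1 * T) x) x := by
  set w := resolvent T 1 (resolvent T lam x) with hw
  have hsym : ∀ a b, inner ℝ (T a) b = inner ℝ a (T b) := fun a b => hT.isSymmetric a b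
  have h1 : ∀ y, T (resolvent T 1 y) + resolvent T 1 y = y := fun y => by
    have h := congrArg (fun A : E →L[ℝ] E => A y) (mul_resolvent hT one_pos)
    simpa using h
  have h2 : ∀ y, T (resolvent T lam y) + lam • resolvent T lam y = y := fun y => by
    have h := congrArg (fun A : E →L[ℝ] E => A y) (mul_resolvent hT hlam)
    simpa using h
  have e1 : resolvent T lam x = T w + w := (h1 _).symm
  have e2 : x = T (T w + w) + lam • (T w + w) := by rw [← e1, h2]
  have e3 : resolvent T 1 x = T w + lam • w := by
    have h3 := congrArg (fun A : E →L[ℝ] E => A (T w + lam • w)) (resolvent_mul hT one_pos)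
    simp only [mul_apply_eq_comp, add_apply, one_smul, one_apply_eq_self] at h3
    rw [← h3, e2]
    congr 1
    simp only [map_add, map_smul, smul_add]
    abel
  have c1 : (resolvent T lam * T) x = T (T w + w) := by
    rw [← (commute_resolvent T lam).eq, mul_apply_eq_comp, e1]
  have c2 : (resolvent T 1 * T) x = T (T w + lam • w) := by
    rw [← (commute_resolvent T 1).eq, mul_apply_eq_comp, e3]
  rw [c1, c2, e2]
  have p1 := hT.inner_nonneg_left w
  have p2 := hT.inner_nonneg_left (T w)
  have p3 : 0 ≤ inner ℝ (T w) (T w) := real_inner_self_nonneg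
  have p4 : 0 ≤ inner ℝ (T (T w)) (T (T w)) := real_inner_self_nonneg
  have q1 : inner ℝ (T (T w)) w = inner ℝ (T w) (T w) := hsym _ _
  have q2 : inner ℝ (T w) (T (T w)) = inner ℝ (T (T w)) (T w) := real_inner_comm _ _
  have l1 : 0 ≤ 1 - lam := by linarith
  have r2 := mul_nonneg l1 p2
  have r3 := mul_nonneg l1 p3
  have r4 := mul_nonneg l1 p4
  have r1 := mul_nonneg l1 p1
  have s1 := mul_nonneg hlam.le r1
  have s2 := mul_nonneg hlam.le r2
  have s3 := mul_nonneg hlam.le r3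
  constructor
  · simp only [map_add, map_smul, inner_add_left, inner_add_right, real_inner_smul_left,
      real_inner_smul_right, q1, q2]
    nlinarith
  · simp only [map_add, map_smul, inner_add_left, inner_add_right, real_inner_smul_left,
      real_inner_smul_right, q1, q2]
    nlinarith

end Resolvent

/-! ### Hilbert-Schmidt norms of adjoints and products -/

section HilbertSchmidt

variable {E : Type*} [NormedAddCommGroup E] [InnerProductSpace ℝ E] [CompleteSpace E]
  {F : Type*} [NormedAddCommGroup F] [InnerProductSpace ℝ F] [CompleteSpace F]

theorem tsum_ofReal_inner_sq {ι : Type*} (b : HilbertBasis ι ℝ E) (x : E) :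
    ∑' i, ENNReal.ofReal (inner ℝ (b i) x ^ 2) = ENNReal.ofReal (‖x‖ ^ 2) := by
  have h := b.hasSum_inner_mul_inner x x
  rw [real_inner_self_eq_norm_sq] at h
  have h' : HasSum (fun i => inner ℝ (b i) x ^ 2) (‖x‖ ^ 2) := by
    have e : (fun i => inner ℝ (b i) x ^ 2) = fun i => inner ℝ x (b i) * inner ℝ (b i) x := by
      ext i
      rw [sq, real_inner_comm x (b i)]
    rw [e]
    exact h
  rw [← h'.tsum_eq, ENNReal.ofReal_tsum_of_nonneg (fun i => sq_nonneg _) h'.summable]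

/-- Parseval in both spaces gives the same double sum of squared matrix entries, summed in either
order. -/
theorem hsNormSq_adjoint (A : E →L[ℝ] F) : hsNormSq A.adjoint = hsNormSq A := by
  unfold hsNormSq
  simp_rw [← tsum_ofReal_inner_sq (onb E) (A.adjoint _), ← tsum_ofReal_inner_sq (onb F) (A _)]
  rw [ENNReal.tsum_comm]
  refine tsum_congr fun i => tsum_congr fun j => ?_
  rw [ContinuousLinearMap.adjoint_inner_right, real_inner_comm]

theorem hsNormSq_comp_le {F' : Type*} [NormedAddCommGroup F'] [InnerProductSpace ℝ F']
    (B : F →L[ℝ] F') (A : E →L[ℝ] F) :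
    hsNormSq (B ∘L A) ≤ ENNReal.ofReal (‖B‖ ^ 2) * hsNormSq A := by
  rw [hsNormSq, hsNormSq, ← ENNReal.tsum_mul_left]
  refine ENNReal.tsum_le_tsum fun i => ?_
  rw [← ENNReal.ofReal_mul (sq_nonneg _), ← mul_pow]
  refine ENNReal.ofReal_le_ofReal ?_
  gcongr
  exact B.le_opNorm _

end HilbertSchmidt

/-! ### Hilbert-Schmidt operators as vectors of a Hilbert space, where the Bernstein inequality
applies -/

section HilbertSchmidtSpace

variable {E : Type*} [NormedAddCommGroup E] [InnerProductSpace ℝ E] [CompleteSpace E]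
  {F : Type*} [NormedAddCommGroup F] [InnerProductSpace ℝ F] [CompleteSpace F]

theorem stronglyMeasurable_of_inner [TopologicalSpace.SeparableSpace E]
    {X : Type*} [MeasurableSpace X] {f : X → E} (h : ∀ w : E, Measurable fun x => inner ℝ w (f x)) :
    StronglyMeasurable f := by
  borelize E
  have : SecondCountableTopology E := UniformSpace.secondCountable_of_separable E
  exact (measurable_of_inner h).stronglyMeasurable

/-- A Hilbert-Schmidt operator as the family of its values on the fixed orthonormal basis. -/
def hsToLp (A : E →L[ℝ] F) (h : hsNormSq A ≠ ∞) : lp (fun _ : onbIndex E => F) 2 :=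
  ⟨fun i => A (onb E i), by
    refine memℓp_gen ?_
    refine (ENNReal.summable_toReal h).congr fun i => ?_
    rw [ENNReal.toReal_ofReal (sq_nonneg _)]
    simp⟩

theorem hsToLp_apply (A : E →L[ℝ] F) (h : hsNormSq A ≠ ∞) (i : onbIndex E) :
    hsToLp A h i = A (onb E i) := rfl

theorem ofReal_norm_lp_sq {ι : Type*} (f : lp (fun _ : ι => F) 2) :
    ENNReal.ofReal (‖f‖ ^ 2) = ∑' i, ENNReal.ofReal (‖f i‖ ^ 2) := by
  have h := lp.hasSum_norm (p := 2) (by norm_num) f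
  simp only [ENNReal.toReal_ofNat, Real.rpow_ofNat] at h
  rw [← h.tsum_eq, ENNReal.ofReal_tsum_of_nonneg (fun i => sq_nonneg _) h.summable]

theorem ofReal_norm_hsToLp_sq (A : E →L[ℝ] F) (h : hsNormSq A ≠ ∞) :
    ENNReal.ofReal (‖hsToLp A h‖ ^ 2) = hsNormSq A := ofReal_norm_lp_sq _

/-- The operator is the ℓ² limit of its truncations to finitely many basis vectors; countability of
the basis makes this a measurable limit. -/
theorem stronglyMeasurable_hsToLp [TopologicalSpace.SeparableSpace E]
    {X : Type*} [MeasurableSpace X] {A : X → E →L[ℝ] F} (h : ∀ x, hsNormSq (A x) ≠ ∞)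
    (hA : ∀ i, StronglyMeasurable fun x => A x (onb E i)) :
    StronglyMeasurable fun x => hsToLp (A x) (h x) := by
  classical
  have := countable_onbIndex (E := E)
  refine stronglyMeasurable_of_tendsto (u := atTop)
    (f := fun (s : Finset (onbIndex E)) x => ∑ i ∈ s,
      lp.singleContinuousLinearMap ℝ (fun _ : onbIndex E => F) 2 i (A x (onb E i))) ?_ ?_
  · intro s
    exact Finset.stronglyMeasurable_fun_sum _ fun i _ =>
      (lp.singleContinuousLinearMap ℝ (fun _ : onbIndex E => F) 2 i).continuous.comp_stronglyMeasurable
        (hA i)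
  · rw [tendsto_pi_nhds]
    intro x
    exact lp.hasSum_single (p := 2) (by norm_num) (hsToLp (A x) (h x))

end HilbertSchmidtSpace

/-! ### Covariance operator, leverage score and effective dimension -/

section Covariance

variable {X : Type*} [MeasurableSpace X]
  {Y : Type*} [NormedAddCommGroup Y] [InnerProductSpace ℝ Y] [CompleteSpace Y]
  [MeasurableSpace Y] [BorelSpace Y] [TopologicalSpace.SeparableSpace Y]
  {H' : Type*} [NormedAddCommGroup H'] [InnerProductSpace ℝ H'] [CompleteSpace H'] [RKHS ℝ H' X Y]
  {κ : ℝ} (hK : KernelAssumption H' κ) (ν : Measure X) [IsProbabilityMeasure ν]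

theorem KernelAssumption.stronglyMeasurable_coe (hK : KernelAssumption H' κ) (g : H') : StronglyMeasurable (g : X → Y) :=
  have : SecondCountableTopology Y := UniformSpace.secondCountable_of_separable Y
  (hK.measurable_coe g).stronglyMeasurable

theorem KernelAssumption.norm_kerFun_le (hK : KernelAssumption H' κ) (x : X) : ‖RKHS.kerFun H' x‖ ≤ |κ| := by
  rw [← LinearIsometryEquiv.norm_map ContinuousLinearMap.adjoint]
  refine ContinuousLinearMap.opNorm_le_bound _ (abs_nonneg _) fun g => ?_
  rw [RKHS.adjoint_kerFun]
  exact hK.norm_apply_le g x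

theorem inclusion_apply (g : H') : inclusion hK ν g = (hK.memLp ν g).toLp g := rfl

theorem inner_covariance (g h : H') :
    inner ℝ (covariance hK ν g) h = ∫ x, inner ℝ (g x) (h x) ∂ν := by
  rw [covariance, ContinuousLinearMap.comp_apply, ContinuousLinearMap.adjoint_inner_left,
    L2.inner_def]
  refine integral_congr_ae ?_
  filter_upwards [(hK.memLp ν g).coeFn_toLp, (hK.memLp ν h).coeFn_toLp] with x h1 h2
  rw [inclusion_apply, inclusion_apply, h1, h2]

theorem inner_covariance_self (g : H') :
    inner ℝ (covariance hK ν g) g = ‖inclusion hK ν g‖ ^ 2 := by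
  rw [covariance, ContinuousLinearMap.comp_apply, ContinuousLinearMap.adjoint_inner_left,
    real_inner_self_eq_norm_sq]

theorem isPositive_covariance : (covariance hK ν).IsPositive :=
  ContinuousLinearMap.isPositive_adjoint_comp_self _

theorem KernelAssumption.integrable_inner (hK : KernelAssumption H' κ)
    (ν : Measure X) [IsProbabilityMeasure ν] (g h : H') :
    Integrable (fun x => inner ℝ (g x) (h x)) ν := by
  refine Integrable.of_bound (C := (|κ| * ‖g‖) * (|κ| * ‖h‖))
    ((hK.stronglyMeasurable_coe g).inner (hK.stronglyMeasurable_coe h)).aestronglyMeasurable ?_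
  refine Eventually.of_forall fun x => (norm_inner_le_norm _ _).trans ?_
  have := hK.norm_apply_le g x
  have := hK.norm_apply_le h x
  gcongr

theorem lintegral_norm_sq (g : H') :
    ∫⁻ x, ENNReal.ofReal (‖g x‖ ^ 2) ∂ν = ENNReal.ofReal (inner ℝ (covariance hK ν g) g) := by
  rw [inner_covariance, ofReal_integral_eq_lintegral_ofReal (hK.integrable_inner ν g g)
    (Eventually.of_forall fun x => real_inner_self_nonneg)]
  simp only [real_inner_self_eq_norm_sq]

/-- The leverage score `‖(T_ν + lam)^{-1/2} K_x‖²_HS`. -/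
def leverage (lam : ℝ) (x : X) : ℝ≥0∞ :=
  hsNormSq ((RKHS.kerFun H' x).adjoint ∘L invSqrt (covariance hK ν) lam)

theorem leverage_eq (lam : ℝ) (x : X) : leverage hK ν lam x
    = ∑' i, ENNReal.ofReal (‖(invSqrt (covariance hK ν) lam (onb H' i)) x‖ ^ 2) := by
  simp [leverage, hsNormSq]

theorem measurable_leverage [TopologicalSpace.SeparableSpace H'] (lam : ℝ) :
    Measurable (leverage hK ν lam) := by
  have := countable_onbIndex (E := H')
  have e : leverage hK ν lam = fun x =>
      ∑' i, ENNReal.ofReal (‖(invSqrt (covariance hK ν) lam (onb H' i)) x‖ ^ 2) :=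
    funext (leverage_eq hK ν lam)
  rw [e]
  refine Measurable.tsum fun i => ?_
  exact ENNReal.measurable_ofReal.comp ((hK.measurable_coe _).norm.pow_const 2)

variable {lam : ℝ}

theorem leverage_le (hlam : 0 < lam) (x : X) :
    leverage hK ν lam x ≤ ENNReal.ofReal (κ ^ 2 / lam) := by
  have hT := isPositive_covariance hK ν
  have e : (RKHS.kerFun H' x).adjoint ∘L invSqrt (covariance hK ν) lam
      = (invSqrt (covariance hK ν) lam ∘L RKHS.kerFun H' x).adjoint := by
    rw [ContinuousLinearMap.adjoint_comp, (isSelfAdjoint_invSqrt hT hlam).adjoint_eq]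
  rw [leverage, e, hsNormSq_adjoint]
  refine (hsNormSq_comp_le _ _).trans ?_
  refine (mul_le_mul' (ENNReal.ofReal_le_ofReal (norm_invSqrt_sq_le hT hlam)) (hK.hs_le x)).trans ?_
  rw [← ENNReal.ofReal_mul (by positivity), inv_mul_eq_div]

theorem leverage_ne_top (hlam : 0 < lam) (x : X) : leverage hK ν lam x ≠ ∞ :=
  ne_top_of_le_ne_top ENNReal.ofReal_ne_top (leverage_le hK ν hlam x)

theorem leverage_toReal_le (hlam : 0 < lam) (x : X) :
    (leverage hK ν lam x).toReal ≤ κ ^ 2 / lam :=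
  ENNReal.toReal_le_of_le_ofReal (by positivity) (leverage_le hK ν hlam x)

theorem sqrt_leverage_le (hlam : 0 < lam) (x : X) :
    √(leverage hK ν lam x).toReal ≤ |κ| / √lam := by
  rw [← Real.sqrt_sq_eq_abs, ← Real.sqrt_div (sq_nonneg κ)]
  exact Real.sqrt_le_sqrt (leverage_toReal_le hK ν hlam x)

/-- The operator (T+λ)^{-1/2}K_x is the adjoint of the one whose squared Hilbert-Schmidt norm is the
leverage. -/
theorem norm_invSqrt_kerFun_le (hlam : 0 < lam) (x : X) (y : Y) :
    ‖invSqrt (covariance hK ν) lam (RKHS.kerFun H' x y)‖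
      ≤ √(leverage hK ν lam x).toReal * ‖y‖ := by
  have hT := isPositive_covariance hK ν
  have h := norm_adjoint_le_of_hsNormSq_le
    ((RKHS.kerFun H' x).adjoint ∘L invSqrt (covariance hK ν) lam)
    √(leverage hK ν lam x).toReal (by
      rw [Real.sq_sqrt ENNReal.toReal_nonneg, ENNReal.ofReal_toReal (leverage_ne_top hK ν hlam x)]
      rfl) y
  rw [ContinuousLinearMap.adjoint_comp, ContinuousLinearMap.adjoint_adjoint,
    (isSelfAdjoint_invSqrt hT hlam).adjoint_eq, abs_of_nonneg (Real.sqrt_nonneg _)] at h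
  exact h

/-- With G = (T+λ)^{-1/2}, sum and integral are exchanged, and each basis vector contributes
∫‖(Ge_i)(x)‖² dν = ⟨TGe_i, Ge_i⟩. -/
theorem lintegral_leverage_aux [TopologicalSpace.SeparableSpace H'] (hlam : 0 < lam) :
    ∫⁻ x, leverage hK ν lam x ∂ν = ∑' i, ENNReal.ofReal
      (inner ℝ ((resolvent (covariance hK ν) lam * covariance hK ν) (onb H' i)) (onb H' i)) := by
  have := countable_onbIndex (E := H')
  have hT := isPositive_covariance hK ν
  simp only [leverage_eq]
  have hm : ∀ g : H', AEMeasurable (fun x => ENNReal.ofReal (‖g x‖ ^ 2)) ν := fun g =>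
    (ENNReal.measurable_ofReal.comp ((hK.measurable_coe g).norm.pow_const 2)).aemeasurable
  rw [lintegral_tsum fun i => hm _]
  refine tsum_congr fun i => ?_
  rw [inner_resolvent_mul hT hlam]
  exact lintegral_norm_sq hK ν _

theorem inner_resolvent_mul_nonneg (hlam : 0 < lam) (x : H') :
    0 ≤ inner ℝ ((resolvent (covariance hK ν) lam * covariance hK ν) x) x := by
  have hT := isPositive_covariance hK ν
  rw [inner_resolvent_mul hT hlam]
  exact hT.inner_nonneg_left _

/-- Finite because the leverage is bounded by κ²/λ. This ensures that the real-valued series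
defining `effDim` is a genuine trace rather than the default value 0. -/
theorem summable_trace [TopologicalSpace.SeparableSpace H'] (hlam : 0 < lam) :
    Summable fun i =>
      inner ℝ ((resolvent (covariance hK ν) lam * covariance hK ν) (onb H' i)) (onb H' i) := by
  have h : ∫⁻ x, leverage hK ν lam x ∂ν ≠ ∞ := by
    refine ne_top_of_le_ne_top (b := ENNReal.ofReal (κ ^ 2 / lam)) ENNReal.ofReal_ne_top
      ((lintegral_mono fun x => leverage_le hK ν hlam x).trans_eq ?_)
    simp
  rw [lintegral_leverage_aux hK ν hlam] at h
  refine (ENNReal.summable_toReal h).congr fun i => ?_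
  exact ENNReal.toReal_ofReal (inner_resolvent_mul_nonneg hK ν hlam _)

theorem lintegral_leverage [TopologicalSpace.SeparableSpace H'] (hlam : 0 < lam) :
    ∫⁻ x, leverage hK ν lam x ∂ν = ENNReal.ofReal (effDim hK ν lam) := by
  rw [lintegral_leverage_aux hK ν hlam, ← ENNReal.ofReal_tsum_of_nonneg
    (fun i => inner_resolvent_mul_nonneg hK ν hlam _) (summable_trace hK ν hlam)]
  rfl

theorem effDim_nonneg (hlam : 0 < lam) : 0 ≤ effDim hK ν lam :=
  tsum_nonneg fun _ => inner_resolvent_mul_nonneg hK ν hlam _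

theorem effDim_one_le [TopologicalSpace.SeparableSpace H'] (hlam : 0 < lam) (hlam1 : lam ≤ 1) :
    effDim hK ν 1 ≤ effDim hK ν lam :=
  (summable_trace hK ν one_pos).tsum_le_tsum
    (fun _ => (resolvent_mul_bounds (isPositive_covariance hK ν) hlam hlam1 _).1)
    (summable_trace hK ν hlam)

theorem mul_effDim_le [TopologicalSpace.SeparableSpace H'] (hlam : 0 < lam) (hlam1 : lam ≤ 1) :
    lam * effDim hK ν lam ≤ effDim hK ν 1 := by
  have h : lam * effDim hK ν lam = ∑' i, lam *
      inner ℝ ((resolvent (covariance hK ν) lam * covariance hK ν) (onb H' i)) (onb H' i) :=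
    tsum_mul_left.symm
  rw [h]
  exact ((summable_trace hK ν hlam).mul_left lam).tsum_le_tsum
    (fun _ => (resolvent_mul_bounds (isPositive_covariance hK ν) hlam hlam1 _).2)
    (summable_trace hK ν one_pos)

theorem leverage_ae_eq_zero [TopologicalSpace.SeparableSpace H'] (hlam : 0 < lam)
    (h : effDim hK ν lam = 0) : ∀ᵐ x ∂ν, leverage hK ν lam x = 0 := by
  have h1 := lintegral_leverage hK ν hlam
  rw [h, ENNReal.ofReal_zero, lintegral_eq_zero_iff (measurable_leverage hK ν lam)] at h1
  exact h1

end Covariance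

theorem one_le_log_four_div {η : ℝ} (hη : 0 < η) (hη1 : η < 1) : 1 ≤ Real.log (4 / η) := by
  rw [Real.le_log_iff_exp_le (by positivity), le_div_iff₀ hη]
  nlinarith [Real.exp_one_lt_d9, Real.exp_pos 1]

/-! ### Concentration at the rate of the effective dimension -/

section Tail

variable {V : Type*} [NormedAddCommGroup V] [InnerProductSpace ℝ V]
  {Ω : Type*} [MeasurableSpace Ω] {μ : Measure Ω} [IsProbabilityMeasure μ] {ξ : Ω → V}

/-- Concentration at rate `√(m N)` of a sum of `m` centred vectors with variance proxy `v N`. -/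
theorem concentration_of_exp (hξ : StronglyMeasurable ξ) (hint : Integrable ξ μ)
    (hmean : ∀ x : V, ∫ ω, inner ℝ x (ξ ω) ∂μ = 0) {N v b lam c N₁ : ℝ} (hN : 0 ≤ N)
    (hv : 0 ≤ v) (h0 : N = 0 → ∀ᵐ ω ∂μ, ξ ω = 0)
    (hc : N ≠ 0 → 0 < c ∧ c * b ≤ N₁ ∧ N₁ ≤ N)
    (hexp : ∀ t, 0 < t → t * b ≤ √lam → ∫⁻ ω, ENNReal.ofReal
      (Real.exp (t * ‖ξ ω‖) - t * ‖ξ ω‖ - 1) ∂μ ≤ ENNReal.ofReal (t ^ 2 * (v * N)))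
    {m : ℕ} (hm : 0 < m) (hNm : N ≤ m * lam) {η : ℝ} (hη : 0 < η) (hη1 : η < 1) :
    MeasurableSet {z : Fin m → Ω |
      ‖∑ i, ξ (z i)‖ ≤ (1 + c ^ 2 * v) / c * √(m * N) * Real.log (4 / η)} ∧
    1 - η / 2 ≤ (Measure.pi fun _ : Fin m => μ).real {z |
      ‖∑ i, ξ (z i)‖ ≤ (1 + c ^ 2 * v) / c * √(m * N) * Real.log (4 / η)} := by
  have hm' : (0 : ℝ) < m := by exact_mod_cast hm
  rcases hN.eq_or_lt with hN0 | hN0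
  -- If N = 0 the claimed radius is 0, and the sum does vanish almost surely.
  · have hae : ∀ᵐ z ∂(Measure.pi fun _ : Fin m => μ), ∀ i, ξ (z i) = 0 :=
      ae_all_iff.2 fun i => (measurePreserving_eval (fun _ : Fin m => μ) i).quasiMeasurePreserving.ae
        (h0 hN0.symm)
    have hsum : StronglyMeasurable fun z : Fin m → Ω => ∑ i, ξ (z i) :=
      Finset.stronglyMeasurable_fun_sum _ fun i _ => hξ.comp_measurable (by fun_prop)
    have hS : MeasurableSet {z : Fin m → Ω |
        ‖∑ i, ξ (z i)‖ ≤ (1 + c ^ 2 * v) / c * √(m * N) * Real.log (4 / η)} :=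
      hsum.norm.measurable measurableSet_Iic
    refine ⟨hS, ?_⟩
    have h1 : (Measure.pi fun _ : Fin m => μ) {z |
        ‖∑ i, ξ (z i)‖ ≤ (1 + c ^ 2 * v) / c * √(m * N) * Real.log (4 / η)} = 1 := by
      rw [← mem_ae_iff_prob_eq_one hS]
      filter_upwards [hae] with z hz
      simp [hz, ← hN0]
    rw [Measure.real, h1, ENNReal.toReal_one]
    linarith
  · obtain ⟨hc0, hcb, hN1⟩ := hc hN0.ne'
    have hs : 0 < √(m * N) := Real.sqrt_pos.2 (by positivity)
    have hlog : Real.exp (-Real.log (4 / η)) = η / 4 := by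
      rw [Real.exp_neg, Real.exp_log (by positivity), inv_div]
    have hlog1 : 1 ≤ Real.log (4 / η) := one_le_log_four_div hη hη1
    -- The parameter t = c/√(mN) is admissible since cb ≤ N₁ ≤ N ≤ √(mN)√λ, the last step being N ≤
    -- mλ.
    have ht : c / √(m * N) * b ≤ √lam := by
      rw [div_mul_eq_mul_div, div_le_iff₀ hs]
      refine (hcb.trans hN1).trans ?_
      have hl : 0 ≤ lam := by
        by_contra hl
        push Not at hl
        nlinarith
      rw [← Real.sqrt_mul hl]
      refine Real.le_sqrt_of_sq_le ?_
      nlinarith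
    have h1 := measureReal_norm_sum_le_ge hξ hint hmean (a := (c / √(m * N)) ^ 2 * (v * N))
      (by positivity) (t := c / √(m * N)) (by positivity) (hexp _ (by positivity) ht) m
      ((1 + c ^ 2 * v) / c * √(m * N) * Real.log (4 / η))
    refine ⟨h1.1, le_trans ?_ h1.2⟩
    -- The prefactor (1 + c²v)/c makes the exponent at most -log(4/η), so the failure probability is
    -- at most 2 · η/4.
    have e1 : m * ((c / √(m * N)) ^ 2 * (v * N)) = c ^ 2 * v := by
      rw [div_pow, Real.sq_sqrt (by positivity)]
      field_simp
    have e2 : c / √(m * N) * ((1 + c ^ 2 * v) / c * √(m * N) * Real.log (4 / η))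
        = (1 + c ^ 2 * v) * Real.log (4 / η) := by
      field_simp
    rw [e1, e2]
    have h3 : Real.exp (c ^ 2 * v - (1 + c ^ 2 * v) * Real.log (4 / η)) ≤ η / 4 := by
      rw [← hlog]
      refine Real.exp_le_exp.2 ?_
      have : 0 ≤ c ^ 2 * v := by positivity
      nlinarith
    linarith

end Tail

/-! ### The weighted noise vectors -/

section Noise

variable {X : Type*} [MeasurableSpace X]
  {Y : Type*} [NormedAddCommGroup Y] [InnerProductSpace ℝ Y] [CompleteSpace Y]
  [MeasurableSpace Y] [BorelSpace Y] [TopologicalSpace.SeparableSpace Y]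
  {H : Type*} [NormedAddCommGroup H] [InnerProductSpace ℝ H] [CompleteSpace H]
  {H' : Type*} [NormedAddCommGroup H'] [InnerProductSpace ℝ H'] [CompleteSpace H'] [RKHS ℝ H' X Y]
  [TopologicalSpace.SeparableSpace H']
  {κ : ℝ} (hK : KernelAssumption H' κ) (ρ : Measure (X × Y)) [IsProbabilityMeasure ρ]
  {k : Kernel X Y} [IsMarkovKernel k] {DA : Set H} {A : H → H'} {fhat : H} {M Sig lam : ℝ}

/-- The noise vector `(T_ν + lam)^{-1/2} K_x (y - g x)`. -/
def noiseVec (lam : ℝ) (g : H') (z : X × Y) : H' :=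
  invSqrt (covariance hK ρ.fst) lam (RKHS.kerFun H' z.1 (z.2 - g z.1))

theorem inner_noiseVec (hlam : 0 < lam) (g w : H') (z : X × Y) :
    inner ℝ w (noiseVec hK ρ lam g z)
      = inner ℝ ((invSqrt (covariance hK ρ.fst) lam w) z.1) (z.2 - g z.1) := by
  rw [noiseVec, ← inner_invSqrt (isPositive_covariance hK ρ.fst) hlam, RKHS.inner_kerFun]

theorem KernelAssumption.stronglyMeasurable_residual (hK : KernelAssumption H' κ) (g : H') :
    StronglyMeasurable fun z : X × Y => z.2 - g z.1 := by
  have : SecondCountableTopology Y := UniformSpace.secondCountable_of_separable Y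
  exact measurable_snd.stronglyMeasurable.sub
    ((hK.stronglyMeasurable_coe g).comp_measurable measurable_fst)

theorem stronglyMeasurable_noiseVec (hlam : 0 < lam) (g : H') :
    StronglyMeasurable (noiseVec hK ρ lam g) := by
  refine stronglyMeasurable_of_inner fun w => ?_
  simp only [inner_noiseVec hK ρ hlam]
  exact (((hK.stronglyMeasurable_coe _).comp_measurable measurable_fst).inner
    (hK.stronglyMeasurable_residual g)).measurable

theorem norm_noiseVec_le (hlam : 0 < lam) (g : H') (z : X × Y) :
    ‖noiseVec hK ρ lam g z‖ ≤ √(leverage hK ρ.fst lam z.1).toReal * ‖z.2 - g z.1‖ :=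
  norm_invSqrt_kerFun_le hK ρ.fst hlam _ _

theorem IsSamplingModel.integrable_residual (hρ : IsSamplingModel ρ k)
    (hK : KernelAssumption H' κ) (g : H') : Integrable (fun z : X × Y => z.2 - g z.1) ρ := by
  have : SecondCountableTopology Y := UniformSpace.secondCountable_of_separable Y
  have h1 : Integrable (fun z : X × Y => z.2) ρ := by
    refine MemLp.integrable (q := 2) (by norm_num) ?_
    exact (memLp_two_iff_integrable_sq_norm measurable_snd.aestronglyMeasurable).2 hρ.integrable_sq
  refine h1.sub (Integrable.of_bound (C := |κ| * ‖g‖) ?_ ?_)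
  · exact ((hK.stronglyMeasurable_coe g).comp_measurable measurable_fst).aestronglyMeasurable
  · exact Eventually.of_forall fun z => hK.norm_apply_le g z.1

theorem IsSamplingModel.integral_eq {ρ : Measure (X × Y)} [IsProbabilityMeasure ρ]
    (hρ : IsSamplingModel ρ k) {f : X × Y → ℝ} (hf : Integrable f ρ) :
    ∫ z, f z ∂ρ = ∫ x, ∫ y, f (x, y) ∂(k x) ∂ρ.fst := by
  conv_lhs => rw [hρ.disintegration]
  exact Measure.integral_compProd (by rwa [← hρ.disintegration])

theorem IsSamplingModel.lintegral_eq {ρ : Measure (X × Y)} [IsProbabilityMeasure ρ]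
    (hρ : IsSamplingModel ρ k) {f : X × Y → ℝ≥0∞} (hf : Measurable f) :
    ∫⁻ z, f z ∂ρ = ∫⁻ x, ∫⁻ y, f (x, y) ∂(k x) ∂ρ.fst := by
  conv_lhs => rw [hρ.disintegration]
  exact Measure.lintegral_compProd hf

theorem integrable_noiseVec (hρ : IsSamplingModel ρ k) (hlam : 0 < lam) (g : H') :
    Integrable (noiseVec hK ρ lam g) ρ := by
  refine ((hρ.integrable_residual ρ hK g).norm.const_mul (|κ| / √lam)).mono'
    (stronglyMeasurable_noiseVec hK ρ hlam g).aestronglyMeasurable (Eventually.of_forall fun z => ?_)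
  refine (norm_noiseVec_le hK ρ hlam g z).trans ?_
  have := sqrt_leverage_le hK ρ.fst hlam z.1
  gcongr

/-- Conditionally on x the residual y - A f̂(x) has mean zero. -/
theorem integral_inner_noiseVec (hρ : IsSamplingModel ρ k) (hf : IsTrueSolution ρ k DA A fhat)
    (hlam : 0 < lam) (w : H') : ∫ z, inner ℝ w (noiseVec hK ρ lam (A fhat) z) ∂ρ = 0 := by
  have hI := (integrable_noiseVec hK ρ hρ hlam (A fhat)).const_inner (𝕜 := ℝ) w
  rw [hρ.integral_eq hI]
  refine integral_eq_zero_of_ae ?_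
  filter_upwards [hf.exists_condExp] with x hx
  simp only [inner_noiseVec hK ρ hlam, Pi.zero_apply]
  have hx' : Integrable (fun y => y - A fhat x) (k x) := hx.sub (integrable_const _)
  rw [integral_inner hx', integral_sub hx (integrable_const _),
    hf.condExp_eq]
  simp

/-- `exp_sub_mul_le` with τ = t√χ M, χ being the leverage at x; τ ≤ 1 by the bound κ²/λ. Keeping χ
pointwise in τ² is what later integrates to N(λ) instead of κ²/λ. -/
theorem ofReal_exp_noiseVec_le (hM : 0 < M) (hlam : 0 < lam) {t : ℝ} (ht : 0 < t)
    (htb : t * (|κ| * M) ≤ √lam) (g : H') (z : X × Y) :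
    ENNReal.ofReal (Real.exp (t * ‖noiseVec hK ρ lam g z‖) - t * ‖noiseVec hK ρ lam g z‖ - 1)
      ≤ leverage hK ρ.fst lam z.1 * (ENNReal.ofReal (t ^ 2 * M ^ 2) * ENNReal.ofReal
        (Real.exp (‖z.2 - g z.1‖ / M) - ‖z.2 - g z.1‖ / M - 1)) := by
  have hs : 0 < √lam := Real.sqrt_pos.2 hlam
  set χ := (leverage hK ρ.fst lam z.1).toReal with hχ
  have hχ0 : 0 ≤ χ := ENNReal.toReal_nonneg
  rw [← ENNReal.ofReal_toReal (leverage_ne_top hK ρ.fst hlam z.1), ← hχ,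
    ← ENNReal.ofReal_mul (by positivity), ← ENNReal.ofReal_mul hχ0]
  refine ENNReal.ofReal_le_ofReal ?_
  have h1 : t * ‖noiseVec hK ρ lam g z‖ ≤ (t * √χ * M) * (‖z.2 - g z.1‖ / M) := by
    have := norm_noiseVec_le hK ρ hlam g z
    calc _ ≤ t * (√χ * ‖z.2 - g z.1‖) := by gcongr
      _ = _ := by field_simp
  refine (exp_sub_mono (by positivity) h1).trans ?_
  have h2 : t * √χ * M ≤ 1 := by
    have := sqrt_leverage_le hK ρ.fst hlam z.1
    rw [← hχ] at this
    calc t * √χ * M ≤ t * (|κ| / √lam) * M := by gcongr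
      _ = t * (|κ| * M) / √lam := by ring
      _ ≤ 1 := (div_le_one hs).2 htb
  refine (exp_sub_mul_le (by positivity) h2 (by positivity)).trans (le_of_eq ?_)
  rw [mul_pow, mul_pow, Real.sq_sqrt hχ0]
  ring

theorem lintegral_exp_noiseVec (hρ : IsSamplingModel ρ k) (hM : 0 < M)
    (hnoise : NoiseCondition ρ k A fhat M Sig) (hlam : 0 < lam) {t : ℝ} (ht : 0 < t)
    (htb : t * (|κ| * M) ≤ √lam) :
    ∫⁻ z, ENNReal.ofReal (Real.exp (t * ‖noiseVec hK ρ lam (A fhat) z‖)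
        - t * ‖noiseVec hK ρ lam (A fhat) z‖ - 1) ∂ρ
      ≤ ENNReal.ofReal (t ^ 2 * (Sig ^ 2 / 2 * effDim hK ρ.fst lam)) := by
  refine (lintegral_mono (ofReal_exp_noiseVec_le hK ρ hM hlam ht htb (A fhat))).trans ?_
  have hmeas : Measurable fun z : X × Y =>
      ENNReal.ofReal (Real.exp (‖z.2 - A fhat z.1‖ / M) - ‖z.2 - A fhat z.1‖ / M - 1) := by
    refine ENNReal.measurable_ofReal.comp ?_
    have h := (hK.stronglyMeasurable_residual (A fhat)).norm.measurable
    fun_prop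
  have hlev := measurable_leverage hK ρ.fst lam
  have hF : Measurable fun z : X × Y => leverage hK ρ.fst lam z.1 *
      (ENNReal.ofReal (t ^ 2 * M ^ 2) * ENNReal.ofReal
        (Real.exp (‖z.2 - A fhat z.1‖ / M) - ‖z.2 - A fhat z.1‖ / M - 1)) :=
    (hlev.comp measurable_fst).mul (hmeas.const_mul _)
  rw [hρ.lintegral_eq hF]
  have hx : ∀ᵐ x ∂ρ.fst, ∫⁻ y, leverage hK ρ.fst lam x * (ENNReal.ofReal (t ^ 2 * M ^ 2) *
      ENNReal.ofReal (Real.exp (‖y - A fhat x‖ / M) - ‖y - A fhat x‖ / M - 1)) ∂(k x)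
      ≤ leverage hK ρ.fst lam x * ENNReal.ofReal (t ^ 2 * (Sig ^ 2 / 2)) := by
    filter_upwards [hnoise] with x hx
    rw [lintegral_const_mul' _ _ (leverage_ne_top hK ρ.fst hlam x),
      lintegral_const_mul' _ _ ENNReal.ofReal_ne_top]
    refine mul_le_mul_right ((mul_le_mul_right hx _).trans (le_of_eq ?_)) _
    rw [← ENNReal.ofReal_mul (by positivity)]
    congr 1
    field_simp
  refine (lintegral_mono_ae hx).trans (le_of_eq ?_)
  rw [lintegral_mul_const _ hlev, lintegral_leverage hK ρ.fst hlam,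
    ← ENNReal.ofReal_mul (effDim_nonneg hK ρ.fst hlam)]
  congr 1
  ring

theorem noiseVec_ae_eq_zero (hlam : 0 < lam) (h : effDim hK ρ.fst lam = 0) (g : H') :
    ∀ᵐ z ∂ρ, noiseVec hK ρ lam g z = 0 := by
  have h1 : ∀ᵐ z ∂ρ, leverage hK ρ.fst lam z.1 = 0 :=
    ae_of_ae_map measurable_fst.aemeasurable (leverage_ae_eq_zero hK ρ.fst hlam h)
  filter_upwards [h1] with z hz
  have := norm_noiseVec_le hK ρ hlam g z
  rw [hz, ENNReal.toReal_zero, Real.sqrt_zero, zero_mul] at this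
  simpa using this

end Noise

/-! ### The weighted error of the empirical covariance -/

section CovarianceError

variable {X : Type*} [MeasurableSpace X]
  {Y : Type*} [NormedAddCommGroup Y] [InnerProductSpace ℝ Y] [CompleteSpace Y]
  [MeasurableSpace Y] [BorelSpace Y] [TopologicalSpace.SeparableSpace Y]
  {H' : Type*} [NormedAddCommGroup H'] [InnerProductSpace ℝ H'] [CompleteSpace H'] [RKHS ℝ H' X Y]
  [TopologicalSpace.SeparableSpace H']
  {κ : ℝ} (hK : KernelAssumption H' κ) (ρ : Measure (X × Y)) [IsProbabilityMeasure ρ] {lam : ℝ}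

theorem integral_fst_eq {f : X → ℝ} (hf : Integrable f ρ.fst) :
    ∫ x, f x ∂ρ.fst = ∫ z, f z.1 ∂ρ :=
  integral_map measurable_fst.aemeasurable hf.aestronglyMeasurable

theorem lintegral_fst_eq {f : X → ℝ≥0∞} (hf : Measurable f) :
    ∫⁻ x, f x ∂ρ.fst = ∫⁻ z, f z.1 ∂ρ :=
  lintegral_map hf measurable_fst

/-- The operator `K_x K_x^* (T_ν + lam)^{-1/2}`. -/
def covOp (lam : ℝ) (x : X) : H' →L[ℝ] H' :=
  RKHS.kerFun H' x ∘L ((RKHS.kerFun H' x).adjoint ∘L invSqrt (covariance hK ρ.fst) lam)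

theorem covOp_apply (x : X) (h : H') : covOp hK ρ lam x h
    = RKHS.kerFun H' x ((invSqrt (covariance hK ρ.fst) lam h) x) := by
  simp [covOp]

theorem hsNormSq_covOp_le (x : X) :
    hsNormSq (covOp hK ρ lam x) ≤ ENNReal.ofReal (κ ^ 2) * leverage hK ρ.fst lam x := by
  refine (hsNormSq_comp_le _ _).trans (mul_le_mul_left (ENNReal.ofReal_le_ofReal ?_) _)
  rw [← sq_abs κ]
  have := hK.norm_kerFun_le x
  gcongr

theorem hsNormSq_covOp_ne_top (hlam : 0 < lam) (x : X) : hsNormSq (covOp hK ρ lam x) ≠ ∞ :=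
  ne_top_of_le_ne_top (ENNReal.mul_ne_top ENNReal.ofReal_ne_top (leverage_ne_top hK ρ.fst hlam x))
    (hsNormSq_covOp_le hK ρ x)

/-- The operator `K_x K_x^* (T_ν + lam)^{-1/2}` in the space of Hilbert-Schmidt operators. -/
def covVec (hlam : 0 < lam) (z : X × Y) : lp (fun _ : onbIndex H' => H') 2 :=
  hsToLp (covOp hK ρ lam z.1) (hsNormSq_covOp_ne_top hK ρ hlam z.1)

theorem norm_covVec_sq_le (hlam : 0 < lam) (z : X × Y) :
    ‖covVec hK ρ hlam z‖ ^ 2 ≤ κ ^ 2 * (leverage hK ρ.fst lam z.1).toReal := by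
  have h := hsNormSq_covOp_le hK ρ (lam := lam) z.1
  rw [← ofReal_norm_hsToLp_sq _ (hsNormSq_covOp_ne_top hK ρ hlam z.1),
    ← ENNReal.ofReal_toReal (leverage_ne_top hK ρ.fst hlam z.1),
    ← ENNReal.ofReal_mul (sq_nonneg κ)] at h
  exact (ENNReal.ofReal_le_ofReal_iff (by positivity)).1 h

theorem norm_covVec_le (hlam : 0 < lam) (z : X × Y) : ‖covVec hK ρ hlam z‖ ≤ κ ^ 2 / √lam := by
  refine abs_le_of_sq_le_sq' ((norm_covVec_sq_le hK ρ hlam z).trans ?_) (by positivity) |>.2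
  rw [div_pow, Real.sq_sqrt hlam.le]
  have := leverage_toReal_le hK ρ.fst hlam z.1
  calc _ ≤ κ ^ 2 * (κ ^ 2 / lam) := by gcongr
    _ = _ := by ring

theorem stronglyMeasurable_covVec (hlam : 0 < lam) : StronglyMeasurable (covVec hK ρ hlam) := by
  refine stronglyMeasurable_hsToLp (A := fun z : X × Y => covOp hK ρ lam z.1)
    (fun z => hsNormSq_covOp_ne_top hK ρ hlam z.1) fun i => ?_
  refine stronglyMeasurable_of_inner fun w => ?_
  simp only [covOp_apply, RKHS.inner_kerFun]
  exact (((hK.stronglyMeasurable_coe _).comp_measurable measurable_fst).inner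
    ((hK.stronglyMeasurable_coe _).comp_measurable measurable_fst)).measurable

theorem integrable_covVec (hlam : 0 < lam) : Integrable (covVec hK ρ hlam) ρ :=
  Integrable.of_bound (stronglyMeasurable_covVec hK ρ hlam).aestronglyMeasurable _
    (Eventually.of_forall (norm_covVec_le hK ρ hlam))

theorem integral_covVec_apply (hlam : 0 < lam) (i : onbIndex H') :
    (∫ z, covVec hK ρ hlam z ∂ρ) i
      = covariance hK ρ.fst (invSqrt (covariance hK ρ.fst) lam (onb H' i)) := by
  classical
  refine ext_inner_left ℝ fun v : H' => ?_
  have hsingle := fun f => lp.inner_single_left (𝕜 := ℝ) (G := fun _ : onbIndex H' => H') i v f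
  refine (hsingle _).symm.trans ?_
  rw [← integral_inner (integrable_covVec hK ρ hlam)]
  simp only [hsingle, covVec, hsToLp_apply, covOp_apply, RKHS.inner_kerFun]
  rw [real_inner_comm, inner_covariance, integral_fst_eq ρ (hK.integrable_inner ρ.fst _ _)]
  refine integral_congr_ae (Eventually.of_forall fun z => ?_)
  exact real_inner_comm _ _

/-- The centred vector is bounded by 2κ²/√λ, so its exponential moment is dominated by t² times the
variance. The variance is at most the second moment, hence at most κ²N(λ). -/
theorem lintegral_exp_covVec (hlam : 0 < lam) {t : ℝ} (ht : 0 < t)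
    (htb : t * (2 * κ ^ 2) ≤ √lam) :
    ∫⁻ z, ENNReal.ofReal (Real.exp (t * ‖covVec hK ρ hlam z - ∫ z, covVec hK ρ hlam z ∂ρ‖)
        - t * ‖covVec hK ρ hlam z - ∫ z, covVec hK ρ hlam z ∂ρ‖ - 1) ∂ρ
      ≤ ENNReal.ofReal (t ^ 2 * (κ ^ 2 * effDim hK ρ.fst lam)) := by
  have hs : 0 < √lam := Real.sqrt_pos.2 hlam
  set c := ∫ z, covVec hK ρ hlam z ∂ρ with hc
  have hcn : ‖c‖ ≤ κ ^ 2 / √lam := by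
    have := norm_integral_le_of_norm_le_const (μ := ρ)
      (Eventually.of_forall (norm_covVec_le hK ρ hlam))
    simpa using this
  have hn : ∀ z, ‖covVec hK ρ hlam z - c‖ ≤ 2 * κ ^ 2 / √lam := fun z => by
    refine (norm_sub_le _ _).trans ((add_le_add (norm_covVec_le hK ρ hlam z) hcn).trans ?_)
    rw [← add_div, two_mul]
  have hI := integrable_covVec hK ρ hlam
  have hsm := stronglyMeasurable_covVec hK ρ hlam
  have hI2 : Integrable (fun z => ‖covVec hK ρ hlam z‖ ^ 2) ρ := by
    refine Integrable.of_bound (C := (κ ^ 2 / √lam) ^ 2)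
      (hsm.norm.pow 2).aestronglyMeasurable (Eventually.of_forall fun z => ?_)
    rw [norm_pow, norm_norm]
    have := norm_covVec_le hK ρ hlam z
    gcongr
  have hI3 : Integrable (fun z => inner ℝ c (covVec hK ρ hlam z)) ρ := hI.const_inner c
  have hvar : ∫ z, ‖covVec hK ρ hlam z - c‖ ^ 2 ∂ρ ≤ ∫ z, ‖covVec hK ρ hlam z‖ ^ 2 ∂ρ := by
    have e : ∀ z, ‖covVec hK ρ hlam z - c‖ ^ 2
        = ‖covVec hK ρ hlam z‖ ^ 2 - 2 * inner ℝ c (covVec hK ρ hlam z) + ‖c‖ ^ 2 := fun z => by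
      rw [norm_sub_sq_real, real_inner_comm]
    simp only [e]
    have hI4 : Integrable (fun z => ‖covVec hK ρ hlam z‖ ^ 2
        - 2 * inner ℝ c (covVec hK ρ hlam z)) ρ := hI2.sub (hI3.const_mul 2)
    rw [integral_add hI4 (integrable_const _), integral_sub hI2 (hI3.const_mul 2),
      integral_const_mul, integral_inner hI, ← hc, real_inner_self_eq_norm_sq, integral_const]
    simp only [probReal_univ, one_smul]
    nlinarith [sq_nonneg ‖c‖]
  have hvar2 : ∫ z, ‖covVec hK ρ hlam z‖ ^ 2 ∂ρ ≤ κ ^ 2 * effDim hK ρ.fst lam := by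
    rw [integral_eq_lintegral_of_nonneg_ae (Eventually.of_forall fun z => sq_nonneg _)
      hI2.aestronglyMeasurable]
    have hN := effDim_nonneg hK ρ.fst hlam
    refine ENNReal.toReal_le_of_le_ofReal (by positivity) ?_
    rw [ENNReal.ofReal_mul (sq_nonneg κ), ← lintegral_leverage hK ρ.fst hlam,
      lintegral_fst_eq ρ (measurable_leverage hK ρ.fst lam),
      ← lintegral_const_mul' _ _ ENNReal.ofReal_ne_top]
    refine lintegral_mono fun z => ?_
    rw [covVec, ofReal_norm_hsToLp_sq]
    exact hsNormSq_covOp_le hK ρ z.1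
  have hJ : Integrable (fun z => t ^ 2 * ‖covVec hK ρ hlam z - c‖ ^ 2) ρ := by
    refine Integrable.const_mul (Integrable.of_bound (C := (2 * κ ^ 2 / √lam) ^ 2)
      ((hsm.sub stronglyMeasurable_const).norm.pow 2).aestronglyMeasurable
      (Eventually.of_forall fun z => ?_)) _
    change ‖‖covVec hK ρ hlam z - c‖ ^ 2‖ ≤ _
    rw [norm_pow, norm_norm]
    have := hn z
    gcongr
  calc _ ≤ ∫⁻ z, ENNReal.ofReal (t ^ 2 * ‖covVec hK ρ hlam z - c‖ ^ 2) ∂ρ := by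
        refine lintegral_mono fun z => ENNReal.ofReal_le_ofReal ?_
        rw [← mul_pow]
        refine exp_sub_le_sq (by positivity) ?_
        calc _ ≤ t * (2 * κ ^ 2 / √lam) := by gcongr; exact hn z
          _ = t * (2 * κ ^ 2) / √lam := by ring
          _ ≤ 1 := (div_le_one hs).2 htb
    _ = ENNReal.ofReal (∫ z, t ^ 2 * ‖covVec hK ρ hlam z - c‖ ^ 2 ∂ρ) :=
        (ofReal_integral_eq_lintegral_ofReal hJ
          (Eventually.of_forall fun z => by positivity)).symm
    _ ≤ _ := by
        refine ENNReal.ofReal_le_ofReal ?_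
        rw [integral_const_mul]
        have := hvar.trans hvar2
        gcongr

theorem covVec_ae_eq_zero (hlam : 0 < lam) (h : effDim hK ρ.fst lam = 0) :
    ∀ᵐ z ∂ρ, covVec hK ρ hlam z - ∫ z, covVec hK ρ hlam z ∂ρ = 0 := by
  have h1 : ∀ᵐ z ∂ρ, leverage hK ρ.fst lam z.1 = 0 :=
    ae_of_ae_map measurable_fst.aemeasurable (leverage_ae_eq_zero hK ρ.fst hlam h)
  have h2 : ∀ᵐ z ∂ρ, covVec hK ρ hlam z = 0 := by
    filter_upwards [h1] with z hz
    have := norm_covVec_sq_le hK ρ hlam z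
    rw [hz, ENNReal.toReal_zero, mul_zero] at this
    rw [← norm_eq_zero]
    exact pow_eq_zero_iff two_ne_zero |>.1 (le_antisymm this (sq_nonneg _))
  have h3 : ∫ z, covVec hK ρ hlam z ∂ρ = 0 := integral_eq_zero_of_ae h2
  filter_upwards [h2] with z hz
  rw [hz, h3, sub_zero]

/-- The sum of the deviations `K_{x_i} K_{x_i}^* - T_ν`. -/
def empErr {m : ℕ} (z : Fin m → X × Y) : H' →L[ℝ] H' :=
  ∑ i, (RKHS.kerFun H' (z i).1 ∘L (RKHS.kerFun H' (z i).1).adjoint - covariance hK ρ.fst)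

theorem inner_empErr {m : ℕ} (z : Fin m → X × Y) (g h : H') :
    inner ℝ (empErr hK ρ z g) h = ∑ i, inner ℝ (g (z i).1) (h (z i).1)
      - m * inner ℝ (covariance hK ρ.fst g) h := by
  simp [empErr, sum_inner, inner_sub_left, Finset.sum_sub_distrib, ← Nat.cast_smul_eq_nsmul ℝ,
    real_inner_smul_left]

theorem isSelfAdjoint_empErr {m : ℕ} (z : Fin m → X × Y) : IsSelfAdjoint (empErr hK ρ z) := by
  rw [ContinuousLinearMap.isSelfAdjoint_iff_isSymmetric]
  intro g h
  have hs := (isPositive_covariance hK ρ.fst).isSymmetric g h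
  simp only [ContinuousLinearMap.coe_coe] at hs ⊢
  rw [real_inner_comm (empErr hK ρ z h), inner_empErr, inner_empErr, hs,
    real_inner_comm (covariance hK ρ.fst h)]
  simp only [real_inner_comm]

/-- The norm of the centred sum is the Hilbert-Schmidt norm of the covariance error times
(T+λ)^{-1/2}, and the operator on the left is its adjoint. One vector bound thus covers all h. -/
theorem norm_invSqrt_empErr_le (hlam : 0 < lam) {m : ℕ} (z : Fin m → X × Y) (h : H') :
    ‖invSqrt (covariance hK ρ.fst) lam (empErr hK ρ z h)‖
      ≤ ‖∑ i, (covVec hK ρ hlam (z i) - ∫ z, covVec hK ρ hlam z ∂ρ)‖ * ‖h‖ := by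
  set G := invSqrt (covariance hK ρ.fst) lam with hG
  set Z := ∑ i, (covVec hK ρ hlam (z i) - ∫ z, covVec hK ρ hlam z ∂ρ) with hZ
  have hGs : G.adjoint = G :=
    (isSelfAdjoint_invSqrt (isPositive_covariance hK ρ.fst) hlam).adjoint_eq
  have e : hsNormSq (empErr hK ρ z ∘L G) = ENNReal.ofReal (‖Z‖ ^ 2) := by
    rw [ofReal_norm_lp_sq, hsNormSq]
    refine tsum_congr fun i => ?_
    congr 3
    rw [hZ, lp.coeFn_sum, Finset.sum_apply]
    simp only [lp.coeFn_sub, Pi.sub_apply, integral_covVec_apply]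
    simp [empErr, covVec, hsToLp_apply, covOp_apply, hG, sum_apply]
  have := norm_adjoint_le_of_hsNormSq_le (empErr hK ρ z ∘L G) ‖Z‖ e.le h
  rwa [ContinuousLinearMap.adjoint_comp, hGs, (isSelfAdjoint_empErr hK ρ z).adjoint_eq,
    abs_norm] at this

end CovarianceError

/-- Scale of the exponential parameter in the concentration bounds. -/
def concRate (κ M N₁ : ℝ) : ℝ := N₁ / (|κ| * M + 2 * κ ^ 2 + 1)

/-- Constant of the concentration bounds. -/
def concConst (κ M Sig N₁ : ℝ) : ℝ :=
  (1 + concRate κ M N₁ ^ 2 * (Sig ^ 2 / 2 + κ ^ 2)) / concRate κ M N₁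

/-! ### The event on which both concentration bounds hold -/

section Event

variable {X : Type*} [MeasurableSpace X]
  {Y : Type*} [NormedAddCommGroup Y] [InnerProductSpace ℝ Y] [CompleteSpace Y]
  [MeasurableSpace Y] [BorelSpace Y] [TopologicalSpace.SeparableSpace Y]
  {H : Type*} [NormedAddCommGroup H] [InnerProductSpace ℝ H] [CompleteSpace H]
  {H' : Type*} [NormedAddCommGroup H'] [InnerProductSpace ℝ H'] [CompleteSpace H'] [RKHS ℝ H' X Y]
  [TopologicalSpace.SeparableSpace H']
  {κ : ℝ} (hK : KernelAssumption H' κ) (ρ : Measure (X × Y)) [IsProbabilityMeasure ρ]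
  {k : Kernel X Y} [IsMarkovKernel k] {DA : Set H} {A : H → H'} {fhat : H} {M Sig lam : ℝ}

theorem exists_concentration_event (hρ : IsSamplingModel ρ k) (hf : IsTrueSolution ρ k DA A fhat)
    (hM : 0 < M) (hnoise : NoiseCondition ρ k A fhat M Sig) (hlam : 0 < lam) (hlam1 : lam ≤ 1)
    {m : ℕ} (hm : 0 < m) (hNm : effDim hK ρ.fst lam ≤ m * lam) {η : ℝ} (hη : 0 < η)
    (hη1 : η < 1) :
    ∃ S : Set (Fin m → X × Y), MeasurableSet S ∧
      1 - η ≤ (Measure.pi fun _ : Fin m => ρ).real S ∧ ∀ z ∈ S,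
        ‖∑ i, noiseVec hK ρ lam (A fhat) (z i)‖ ≤ concConst κ M Sig (effDim hK ρ.fst 1)
          * √(m * effDim hK ρ.fst lam) * Real.log (4 / η) ∧
        ∀ h, ‖invSqrt (covariance hK ρ.fst) lam (empErr hK ρ z h)‖
          ≤ concConst κ M Sig (effDim hK ρ.fst 1)
            * √(m * effDim hK ρ.fst lam) * Real.log (4 / η) * ‖h‖ := by
  set N := effDim hK ρ.fst lam with hN
  set N₁ := effDim hK ρ.fst 1 with hN₁
  have hN0 : 0 ≤ N := effDim_nonneg hK ρ.fst hlam
  have hN10 : 0 ≤ N₁ := effDim_nonneg hK ρ.fst one_pos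
  -- The denominator of `concRate` dominates both |κ|M (noise) and 2κ² (covariance). If N(λ) > 0,
  -- then N(1) ≥ λN(λ) > 0, so the rate is positive. Using N(1) as a lower bound for N(λ) keeps the
  -- constant independent of λ.
  have hrate : ∀ b, b ≤ |κ| * M + 2 * κ ^ 2 + 1 → N ≠ 0 →
      0 < concRate κ M N₁ ∧ concRate κ M N₁ * b ≤ N₁ ∧ N₁ ≤ N := by
    intro b hb hne
    have hden : 0 < |κ| * M + 2 * κ ^ 2 + 1 := by positivity
    have hpos : 0 < N₁ := by
      have h1 := mul_effDim_le hK ρ.fst hlam hlam1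
      have h2 : 0 < lam * N := mul_pos hlam (lt_of_le_of_ne hN0 hne.symm)
      exact h2.trans_le h1
    refine ⟨div_pos hpos hden, ?_, effDim_one_le hK ρ.fst hlam hlam1⟩
    rw [concRate, div_mul_eq_mul_div, div_le_iff₀ hden]
    gcongr
  have hv : 0 ≤ Sig ^ 2 / 2 + κ ^ 2 := by positivity
  have h1 := concentration_of_exp (stronglyMeasurable_noiseVec hK ρ hlam (A fhat))
    (integrable_noiseVec hK ρ hρ hlam (A fhat)) (integral_inner_noiseVec hK ρ hρ hf hlam)
    hN0 hv (fun h => noiseVec_ae_eq_zero hK ρ hlam h (A fhat))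
    (hrate (|κ| * M) (by nlinarith [sq_nonneg κ])) (fun t ht htb =>
      (lintegral_exp_noiseVec hK ρ hρ hM hnoise hlam ht htb).trans
        (ENNReal.ofReal_le_ofReal (by gcongr; nlinarith [sq_nonneg κ]))) hm hNm hη hη1
  have hcI := integrable_covVec hK ρ hlam
  have hcI' : Integrable (fun z => covVec hK ρ hlam z - ∫ z, covVec hK ρ hlam z ∂ρ) ρ :=
    hcI.sub (integrable_const _)
  have h2 := concentration_of_exp
    (ξ := fun z => covVec hK ρ hlam z - ∫ z, covVec hK ρ hlam z ∂ρ)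
    ((stronglyMeasurable_covVec hK ρ hlam).sub stronglyMeasurable_const)
    hcI' (fun x => by
      rw [integral_inner hcI', integral_sub hcI (integrable_const _)]
      simp) hN0 hv (covVec_ae_eq_zero hK ρ hlam)
    (hrate (2 * κ ^ 2) (by nlinarith [mul_nonneg (abs_nonneg κ) hM.le])) (fun t ht htb =>
      (lintegral_exp_covVec hK ρ hlam ht htb).trans
        (ENNReal.ofReal_le_ofReal (by gcongr; nlinarith [sq_nonneg Sig]))) hm hNm hη hη1
  refine ⟨_, h1.1.inter h2.1, ?_, fun z hz => ⟨hz.1, fun h => ?_⟩⟩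
  -- Union bound: each of the two events fails with probability at most η/2.
  · set P := Measure.pi fun _ : Fin m => ρ
    have h3 := probReal_compl_eq_one_sub (μ := P) h1.1
    have h4 := probReal_compl_eq_one_sub (μ := P) h2.1
    have h5 := probReal_compl_eq_one_sub (μ := P) (h1.1.inter h2.1)
    rw [Set.compl_inter] at h5
    have h6 := measureReal_union_le (μ := P) _ _ |>.trans' h5.ge
    rw [h3, h4] at h6
    linarith [h1.2, h2.2]
  · refine (norm_invSqrt_empErr_le hK ρ hlam z h).trans ?_
    exact mul_le_mul_of_nonneg_right hz.2 (norm_nonneg h)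

end Event

/-! ### Comparison of Tikhonov functionals -/

section Deterministic

variable {X : Type*} [MeasurableSpace X]
  {Y : Type*} [NormedAddCommGroup Y] [InnerProductSpace ℝ Y] [CompleteSpace Y]
  [MeasurableSpace Y] [BorelSpace Y] [TopologicalSpace.SeparableSpace Y]
  {H : Type*} [NormedAddCommGroup H] [InnerProductSpace ℝ H] [CompleteSpace H]
  {H' : Type*} [NormedAddCommGroup H'] [InnerProductSpace ℝ H'] [CompleteSpace H'] [RKHS ℝ H' X Y]
  [TopologicalSpace.SeparableSpace H']
  {κ : ℝ} (hK : KernelAssumption H' κ) (ρ : Measure (X × Y)) [IsProbabilityMeasure ρ]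
  {L : H →ₗ.[ℝ] H} {DA : Set H} {A : H → H'} {fhat : H} {lam : ℝ}

/-- Comparing a Tikhonov estimator with another admissible element, in terms of the empirical
errors. -/
theorem tikhonov_comparison {fbar f g : L.domain} {m : ℕ} (hm : 0 < m) {z : Fin m → X × Y}
    (hest : IsTikhonovEstimator L DA A fbar z lam f) (hg : (g : H) ∈ DA) :
    m * (‖inclusion hK ρ.fst (A f - A g)‖ ^ 2 + lam * ‖L (f - g)‖ ^ 2)
      ≤ - inner ℝ (A f - A g) (empErr hK ρ z (A f - A g))
        - 2 * inner ℝ (A f - A g) (empErr hK ρ z (A g - A fhat))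
        - 2 * m * inner ℝ (inclusion hK ρ.fst (A f - A g)) (inclusion hK ρ.fst (A g - A fhat))
        + 2 * inner ℝ (A f - A g) (∑ i, RKHS.kerFun H' (z i).1 ((z i).2 - A fhat (z i).1))
        - 2 * m * lam * inner ℝ (L (f - g)) (L (g - fbar)) := by
  have hm' : (0 : ℝ) < m := by exact_mod_cast hm
  have h0 := hest.2 g hg
  unfold tikhonov at h0
  set h := A f - A g with hh
  set e := A g - A fhat with he
  -- The residual of f is that of g plus h, and the residual of g is e minus the noise.
  have h1 : ∀ i, ‖A f (z i).1 - (z i).2‖ ^ 2 = ‖A g (z i).1 - (z i).2‖ ^ 2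
      + inner ℝ (h (z i).1) (h (z i).1) + 2 * inner ℝ (e (z i).1) (h (z i).1)
      - 2 * inner ℝ (h (z i).1) ((z i).2 - A fhat (z i).1) := by
    intro i
    have e1 : A f (z i).1 - (z i).2 = (A g (z i).1 - (z i).2) + h (z i).1 := by
      rw [hh, RKHS.coe_sub, Pi.sub_apply]; abel
    have e2 : A g (z i).1 - (z i).2 = e (z i).1 - ((z i).2 - A fhat (z i).1) := by
      rw [he, RKHS.coe_sub, Pi.sub_apply]; abel
    have e3 : inner ℝ (A g (z i).1 - (z i).2) (h (z i).1) = inner ℝ (e (z i).1) (h (z i).1)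
        - inner ℝ (h (z i).1) ((z i).2 - A fhat (z i).1) := by
      rw [e2, inner_sub_left, real_inner_comm (h (z i).1) ((z i).2 - A fhat (z i).1)]
    rw [e1, norm_add_sq_real, e3, real_inner_self_eq_norm_sq]
    ring
  have h2 : ‖L (f - fbar)‖ ^ 2 = ‖L (g - fbar)‖ ^ 2 + ‖L (f - g)‖ ^ 2
      + 2 * inner ℝ (L (f - g)) (L (g - fbar)) := by
    have : L (f - fbar) = L (f - g) + L (g - fbar) := by rw [← LinearPMap.map_add]; congr 1; abel
    rw [this, norm_add_sq_real]
    ring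
  have h3 := inner_empErr hK ρ z h h
  have h4 := inner_empErr hK ρ z e h
  rw [inner_covariance_self] at h3
  have h5 : inner ℝ (covariance hK ρ.fst e) h
      = inner ℝ (inclusion hK ρ.fst h) (inclusion hK ρ.fst e) := by
    rw [covariance, ContinuousLinearMap.comp_apply, ContinuousLinearMap.adjoint_inner_left,
      real_inner_comm]
  rw [h5] at h4
  have h6 : inner ℝ h (∑ i, RKHS.kerFun H' (z i).1 ((z i).2 - A fhat (z i).1))
      = ∑ i, inner ℝ (h (z i).1) ((z i).2 - A fhat (z i).1) := by
    rw [inner_sum]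
    exact Finset.sum_congr rfl fun i _ => RKHS.inner_kerFun _ _ _
  simp only [h1, Finset.sum_add_distrib, Finset.sum_sub_distrib, ← Finset.mul_sum] at h0
  rw [← h6, h2] at h0
  rw [real_inner_comm] at h3 h4
  have h7 := mul_le_mul_of_nonneg_left h0 hm'.le
  have h8 : ∀ a b : ℝ, m * (1 / m * a + b) = a + m * b := fun a b => by field_simp
  rw [h8, h8] at h7
  linarith

end Deterministic

/-! ### Solving the scalar inequality -/

section RealLemmas

/-- For t ≥ 1 both powers on the right are at most t^{2-g} with g = min(1, γ); dividing leaves t^g ≤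
K₁ + K₂. -/
theorem le_of_sq_le_rpow {K₁ K₂ γ t : ℝ} (hK₁ : 0 ≤ K₁) (hK₂ : 0 ≤ K₂) (hγ : 0 < γ) (ht : 1 ≤ t)
    (h : t ^ 2 ≤ K₁ * t + K₂ * t ^ (2 - γ)) : t ≤ (K₁ + K₂) ^ (1 / min 1 γ) := by
  set g := min 1 γ with hg
  have hg0 : 0 < g := lt_min one_pos hγ
  have ht0 : 0 < t := one_pos.trans_le ht
  have h1 : t ≤ t ^ (2 - g) := by
    conv_lhs => rw [← Real.rpow_one t]
    exact Real.rpow_le_rpow_of_exponent_le ht (by linarith [min_le_left 1 γ])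
  have h2 : t ^ (2 - γ) ≤ t ^ (2 - g) :=
    Real.rpow_le_rpow_of_exponent_le ht (by linarith [min_le_right 1 γ])
  have h3 : t ^ 2 = t ^ (2 - g) * t ^ g := by
    rw [← Real.rpow_add ht0, sub_add_cancel, Real.rpow_two]
  have h4 : t ^ g ≤ K₁ + K₂ := by
    have hp : 0 < t ^ (2 - g) := by positivity
    refine le_of_mul_le_mul_left (a := t ^ (2 - g)) ?_ hp
    rw [← h3]
    nlinarith [mul_le_mul_of_nonneg_left h1 hK₁, mul_le_mul_of_nonneg_left h2 hK₂]
  have h5 : t = (t ^ g) ^ (1 / g) := by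
    rw [← Real.rpow_mul ht0.le, mul_one_div_cancel hg0.ne', Real.rpow_one]
  rw [h5]
  exact Real.rpow_le_rpow (by positivity) h4 (by positivity)

/-- Homogeneity in P: since sβ + (1-β) = 2 - γ and Q₀ ≤ P^γ, dividing by P² leaves an inequality in
t = max(u, y)/P alone. Only t ≥ 1 needs an argument; there d ≤ P ≤ max(u, y). -/
theorem max_le_of_balance {u y d P Q₀ k ℓ b β s γ : ℝ} (hu : 0 ≤ u) (hy : 0 ≤ y) (hd : 0 ≤ d)
    (hP : 0 < P) (hdP : d ≤ P) (hQ : Q₀ ≤ P ^ γ) (hβ : 0 ≤ β) (hβ1 : β ≤ 1) (hs : 0 < s)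
    (hγ : γ = 1 + β - s * β) (hγ0 : 0 < γ) (hk : 0 ≤ k) (hℓ : 0 ≤ ℓ) (hb : 0 ≤ b)
    (h : u ^ 2 + y ^ 2 ≤ k * P * (u + ℓ * y) + 2 * u * d
      + b * Q₀ * ((u + d) ^ (s * β) * y ^ (1 - β))) :
    max u y ≤ max 1 ((k * (1 + ℓ) + 2 + b * 2 ^ (s * β)) ^ (1 / min 1 γ)) * P := by
  set x := max u y with hx
  have hux : u ≤ x := le_max_left _ _
  have hyx : y ≤ x := le_max_right _ _
  rcases le_total x P with hxP | hxP
  · refine hxP.trans ?_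
    have := mul_le_mul_of_nonneg_right (le_max_left 1
      ((k * (1 + ℓ) + 2 + b * 2 ^ (s * β)) ^ (1 / min 1 γ))) hP.le
    linarith
  have hx0 : 0 < x := hP.trans_le hxP
  have ht : 1 ≤ x / P := (one_le_div hP).2 hxP
  have hβ' : 0 ≤ 1 - β := by linarith
  have hsq : x ^ 2 ≤ u ^ 2 + y ^ 2 := by
    rcases max_choice u y with h' | h' <;> rw [hx, h'] <;> nlinarith
  have e1 : (u + d) ^ (s * β) * y ^ (1 - β) ≤ 2 ^ (s * β) * x ^ (2 - γ) := by
    calc (u + d) ^ (s * β) * y ^ (1 - β) ≤ (2 * x) ^ (s * β) * x ^ (1 - β) := by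
          gcongr
          linarith
      _ = 2 ^ (s * β) * x ^ (2 - γ) := by
          rw [Real.mul_rpow (by norm_num) hx0.le, mul_assoc, ← Real.rpow_add hx0]
          congr 2
          rw [hγ]; ring
  have e2 : x ^ 2 ≤ k * P * (x + ℓ * x) + 2 * x * P
      + b * P ^ γ * (2 ^ (s * β) * x ^ (2 - γ)) := by
    refine hsq.trans (h.trans ?_)
    gcongr
  have e3 : P ^ γ * x ^ (2 - γ) = P ^ 2 * (x / P) ^ (2 - γ) := by
    rw [Real.div_rpow hx0.le hP.le, ← Real.rpow_two, mul_div_assoc', mul_comm (P ^ (2 : ℝ)),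
      mul_div_assoc, ← Real.rpow_sub hP]
    rw [show (2 : ℝ) - (2 - γ) = γ by ring, mul_comm]
  have e4 : (x / P) ^ 2 ≤ (k * (1 + ℓ) + 2) * (x / P) + b * 2 ^ (s * β) * (x / P) ^ (2 - γ) := by
    refine le_of_mul_le_mul_left (a := P ^ 2) ?_ (by positivity)
    have e5 : P ^ 2 * (x / P) ^ 2 = x ^ 2 := by field_simp
    have e6 : P ^ 2 * ((k * (1 + ℓ) + 2) * (x / P) + b * 2 ^ (s * β) * (x / P) ^ (2 - γ))
        = k * P * (x + ℓ * x) + 2 * x * P + b * 2 ^ (s * β) * (P ^ 2 * (x / P) ^ (2 - γ)) := by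
      field_simp
    rw [e5, e6, ← e3]
    linarith
  have e7 := le_of_sq_le_rpow (by positivity) (by positivity) hγ0 ht e4
  rw [div_le_iff₀ hP] at e7
  refine e7.trans ?_
  gcongr
  exact le_max_right _ _

end RealLemmas

/-! ### The basic inequality for the estimator -/

section Deterministic

variable {X : Type*} [MeasurableSpace X]
  {Y : Type*} [NormedAddCommGroup Y] [InnerProductSpace ℝ Y] [CompleteSpace Y]
  [MeasurableSpace Y] [BorelSpace Y] [TopologicalSpace.SeparableSpace Y]
  {H : Type*} [NormedAddCommGroup H] [InnerProductSpace ℝ H] [CompleteSpace H]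
  {H' : Type*} [NormedAddCommGroup H'] [InnerProductSpace ℝ H'] [CompleteSpace H'] [RKHS ℝ H' X Y]
  [TopologicalSpace.SeparableSpace H']
  {κ : ℝ} {hK : KernelAssumption H' κ} {ρ : Measure (X × Y)} [IsProbabilityMeasure ρ]
  {L : H →ₗ.[ℝ] H} {DA Q : Set H} {A : H → H'} {fhat : H} {lam ℓL ℓA r p q s α d θ : ℝ}

/-- The increment h = A f - A g is bounded in two ways: by 2ℓ_A r where the covariance error acts on
it, and by (ℓ_A/ℓ_L)‖L(f-g)‖ inside the weight. The three stochastic terms contribute 2ℓ_A r, 2ℓ_A r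
and 2, whence the factor 2(2ℓ_A r + 1). -/
theorem estimator_inequality (hL : IsScaleGenerator L ℓL) (hlam : 0 < lam) (hfhat : fhat ∈ DA)
    (hA : ForwardAssumption L hK ρ.fst DA A fhat ℓA r p s α d θ Q)
    {fbar f g : L.domain} {m : ℕ} (hm : 0 < m) {z : Fin m → X × Y}
    (hest : IsTikhonovEstimator L DA A fbar z lam f) (hf : (f : H) ∈ Q) (hg : (g : H) ∈ Q)
    {v : H} {R : ℝ} (hv : L (g - fbar) = negPow L (q - 1) v) (hvR : ‖v‖ ≤ R) {D : ℝ}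
    (hD : ‖∑ i, noiseVec hK ρ lam (A fhat) (z i)‖ ≤ m * D)
    (hD' : ∀ h, ‖invSqrt (covariance hK ρ.fst) lam (empErr hK ρ z h)‖ ≤ m * D * ‖h‖) :
    ‖inclusion hK ρ.fst (A f - A g)‖ ^ 2 + lam * ‖L (f - g)‖ ^ 2
      ≤ 2 * (2 * ℓA * r + 1) * D
          * (‖inclusion hK ρ.fst (A f - A g)‖ + ℓA / ℓL * (√lam * ‖L (f - g)‖))
        + 2 * ‖inclusion hK ρ.fst (A f - A g)‖ * ‖inclusion hK ρ.fst (A g - A fhat)‖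
        + 2 * lam * R * ‖negPow L (q - 1) (L (f - g))‖ := by
  have hm' : (0 : ℝ) < m := by exact_mod_cast hm
  have hcmp := tikhonov_comparison (fhat := fhat) hK ρ hm hest (hA.Q_subset_domain hg)
  set h := A f - A g with hh
  set e := A g - A fhat with he
  set u := ‖inclusion hK ρ.fst h‖ with hu
  set w := L (f - g) with hw
  have hr := hA.radius_pos
  have hℓA := hA.lipschitz_nonneg
  have hℓL := hL.lower_pos
  have mf : (f : H) ∈ Metric.closedBall fhat r ∩ DA :=
    ⟨hA.Q_subset_closedBall hf, hA.Q_subset_domain hf⟩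
  have mg : (g : H) ∈ Metric.closedBall fhat r ∩ DA :=
    ⟨hA.Q_subset_closedBall hg, hA.Q_subset_domain hg⟩
  have m0 : fhat ∈ Metric.closedBall fhat r ∩ DA := ⟨Metric.mem_closedBall_self hr.le, hfhat⟩
  have hfr : ‖(f : H) - fhat‖ ≤ r := by rw [← dist_eq_norm]; exact mf.1
  have hgr : ‖(g : H) - fhat‖ ≤ r := by rw [← dist_eq_norm]; exact mg.1
  have hfg : ‖(f : H) - g‖ ≤ 2 * r := by
    have := norm_sub_le ((f : H) - fhat) (g - fhat)
    rw [sub_sub_sub_cancel_right] at this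
    linarith
  have hh0 : ‖h‖ ≤ ℓA * ‖(f : H) - g‖ := hA.lipschitz _ mf _ mg
  have hh1 : ‖h‖ ≤ 2 * ℓA * r := by nlinarith
  have hh2 : ‖h‖ ≤ ℓA / ℓL * ‖w‖ := by
    have := hL.lower (f - g)
    rw [Submodule.coe_sub] at this
    rw [div_mul_eq_mul_div, le_div_iff₀ hℓL]
    nlinarith
  have he1 : ‖e‖ ≤ ℓA * r := (hA.lipschitz _ mg _ m0).trans (by gcongr)
  have hD0 : 0 ≤ D := by
    have := (norm_nonneg _).trans hD
    exact nonneg_of_mul_nonneg_right this hm'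
  have hT := isPositive_covariance hK ρ.fst
  set Z := u + ℓA / ℓL * (√lam * ‖w‖) with hZ
  have hZ0 : 0 ≤ Z := by positivity
  have hroot : √(inner ℝ (covariance hK ρ.fst h) h + lam * ‖h‖ ^ 2) ≤ Z := by
    rw [inner_covariance_self, ← hu]
    have h1 : √lam * ‖h‖ ≤ ℓA / ℓL * (√lam * ‖w‖) := by
      calc _ ≤ √lam * (ℓA / ℓL * ‖w‖) := by gcongr
        _ = _ := by ring
    have h2 : √(u ^ 2 + lam * ‖h‖ ^ 2) ≤ u + √lam * ‖h‖ := by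
      refine Real.sqrt_le_iff.2 ⟨by positivity, ?_⟩
      have h3 : lam * ‖h‖ ^ 2 = (√lam * ‖h‖) ^ 2 := by rw [mul_pow, Real.sq_sqrt hlam.le]
      rw [h3]
      have : 0 ≤ u * (√lam * ‖h‖) := by positivity
      nlinarith
    exact h2.trans (by linarith)
  have key : ∀ (ζ : H') (c : ℝ), ‖invSqrt (covariance hK ρ.fst) lam ζ‖ ≤ m * D * c →
      |inner ℝ h ζ| ≤ Z * (m * D * c) := fun ζ c hζ =>
    (abs_inner_le_invSqrt hT hlam h ζ).trans (mul_le_mul hroot hζ (norm_nonneg _) hZ0)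
  have hmD : 0 ≤ m * D := by positivity
  have k1 := key (empErr hK ρ z h) (2 * ℓA * r) ((hD' h).trans (by gcongr))
  have k2 := key (empErr hK ρ z e) (ℓA * r) ((hD' e).trans (by gcongr))
  have k3 := key (∑ i, RKHS.kerFun H' (z i).1 ((z i).2 - A fhat (z i).1)) 1 (by
    rw [map_sum, mul_one]; exact hD)
  have k4 := abs_real_inner_le_norm (inclusion hK ρ.fst h) (inclusion hK ρ.fst e)
  have k5 : |inner ℝ w (L (g - fbar))| ≤ R * ‖negPow L (q - 1) w‖ := by
    rw [hv, ← ContinuousLinearMap.adjoint_inner_left, (hL.isSelfAdjoint_negPow _).adjoint_eq,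
      mul_comm]
    refine (abs_real_inner_le_norm _ _).trans ?_
    gcongr
  refine le_of_mul_le_mul_left (a := (m : ℝ)) ?_ hm'
  refine hcmp.trans ?_
  have b1 := (abs_le.1 k1).1
  have b2 := (abs_le.1 k2).1
  have b3 := (abs_le.1 k3).2
  have b4 := mul_le_mul_of_nonneg_left (abs_le.1 k4).1 hm'.le
  have b5 := mul_le_mul_of_nonneg_left (abs_le.1 k5).1 (mul_pos hm' hlam).le
  nlinarith

/-- The left side is ‖f - g‖_{-p}; the triangle inequality through f̂ and stability at f and at g
bound it. -/
theorem norm_negPow_add_one_le (hL : IsScaleGenerator L ℓL) (hp : 0 ≤ p) (hs : 0 < s) (hα : 0 < α)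
    (hA : ForwardAssumption L hK ρ.fst DA A fhat ℓA r p s α d θ Q) {f g : L.domain}
    (hf : (f : H) ∈ Q) (hg : (g : H) ∈ Q) :
    ‖negPow L (p + 1) (L (f - g))‖ ≤ 2 * α * (‖inclusion hK ρ.fst (A f - A g)‖
      + ‖inclusion hK ρ.fst (A g - A fhat)‖) ^ s := by
  rw [hL.negPow_add hp zero_le_one, negPow_one, mul_apply_eq_comp, hL.invOp_apply]
  have e : ((f - g : L.domain) : H) = (f - fhat) - (g - fhat) := by
    rw [Submodule.coe_sub]; abel
  rw [e, map_sub]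
  have h1 := hA.stability _ hf
  have h2 := hA.stability _ hg
  have h3 : ‖inclusion hK ρ.fst (A f - A fhat)‖ ≤ ‖inclusion hK ρ.fst (A f - A g)‖
      + ‖inclusion hK ρ.fst (A g - A fhat)‖ := by
    rw [← sub_add_sub_cancel (A f) (A g) (A fhat), map_add]
    exact norm_add_le _ _
  have h4 : ‖inclusion hK ρ.fst (A g - A fhat)‖ ≤ ‖inclusion hK ρ.fst (A f - A g)‖
      + ‖inclusion hK ρ.fst (A g - A fhat)‖ := le_add_of_nonneg_left (norm_nonneg _)
  have h5 := Real.rpow_le_rpow (norm_nonneg _) h3 hs.le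
  have h6 := Real.rpow_le_rpow (norm_nonneg _) h4 hs.le
  refine (norm_sub_le _ _).trans ((add_le_add h1 h2).trans ?_)
  nlinarith

end Deterministic

/-! ### Exponents and constants of the rates -/

section Rates

/-- Constant of the bounds in the image space and in the domain of `L`. -/
def rateConst (p q s ℓ ℓ₁ α c : ℝ) : ℝ :=
  max 1 ((2 * (|ℓ₁| + 1) * |c| * (1 + |ℓ|) + 2
      + 2 * (2 * α) ^ ((q - 1) / (p + 1)) * 2 ^ (s * ((q - 1) / (p + 1))))
    ^ (1 / min 1 (1 + (q - 1) / (p + 1) - s * ((q - 1) / (p + 1)))))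

theorem rateConst_pos (p q s ℓ ℓ₁ α c : ℝ) : 0 < rateConst p q s ℓ ℓ₁ α c :=
  one_pos.trans_le (le_max_left _ _)

/-- The bounds in the image space and in the domain of `L`, from the basic inequality. -/
theorem max_le_rateConst_mul {p q s ℓ ℓ₁ α c : ℝ} (hp : 0 ≤ p) (hs : 0 < s) (hα : 0 < α)
    (hq₁ : 1 ≤ q) (hq₂ : q ≤ 2 + p) (hqs : q * (s - 1) < p + s) {u w d D P R lam a b : ℝ}
    (hℓ : 0 ≤ ℓ) (hℓ₁ : 0 ≤ ℓ₁) (hu : 0 ≤ u) (hw : 0 ≤ w) (hd : 0 ≤ d) (hlam : 0 < lam)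
    (hR : 0 < R) (hP : 0 < P) (hdP : d ≤ P) (hDP : D ≤ |c| * P) (ha0 : 0 ≤ a)
    (hRP : R * lam ^ ((1 + (q - 1) / (p + 1)) / 2)
      ≤ P ^ (1 + (q - 1) / (p + 1) - s * ((q - 1) / (p + 1))))
    (ha : a ≤ 2 * α * (u + d) ^ s) (hb : b ≤ a ^ ((q - 1) / (p + 1)) * w ^ (1 - (q - 1) / (p + 1)))
    (h : u ^ 2 + lam * w ^ 2 ≤ 2 * (ℓ₁ + 1) * D * (u + ℓ * (√lam * w)) + 2 * u * d
      + 2 * lam * R * b) :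
    max u (√lam * w) ≤ rateConst p q s ℓ ℓ₁ α c * P := by
  set β := (q - 1) / (p + 1) with hβ
  have hp1 : 0 < p + 1 := by linarith
  have hβ0 : 0 ≤ β := div_nonneg (by linarith) hp1.le
  have hβ1 : β ≤ 1 := by rw [hβ, div_le_one hp1]; linarith
  -- Up to the factor p + 1 this is exactly the hypothesis q(s-1) < p + s, as 0 ≤ β ≤ 1 is 1 ≤ q ≤ 2
  -- + p.
  have hγ : 0 < 1 + β - s * β := by
    have : 1 + β - s * β = (p + s - q * (s - 1)) / (p + 1) := by
      rw [hβ]; field_simp; ring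
    rw [this]
    exact div_pos (by linarith) hp1
  have hsl : 0 < √lam := Real.sqrt_pos.2 hlam
  have hb' : b ≤ (2 * α) ^ β * (u + d) ^ (s * β) * w ^ (1 - β) := by
    refine hb.trans ?_
    have h1 : a ^ β ≤ (2 * α * (u + d) ^ s) ^ β := Real.rpow_le_rpow ha0 ha hβ0
    rw [Real.mul_rpow (by positivity) (by positivity), ← Real.rpow_mul (by positivity)] at h1
    gcongr
  have hlw : lam * w ^ (1 - β) = lam ^ ((1 + β) / 2) * (√lam * w) ^ (1 - β) := by
    rw [Real.mul_rpow hsl.le hw, Real.sqrt_eq_rpow, ← Real.rpow_mul hlam.le, ← mul_assoc,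
      ← Real.rpow_add hlam]
    congr 1
    rw [show (1 + β) / 2 + 1 / 2 * (1 - β) = 1 by ring, Real.rpow_one]
  have e0 : lam * w ^ 2 = (√lam * w) ^ 2 := by rw [mul_pow, Real.sq_sqrt hlam.le]
  rw [rateConst, abs_of_nonneg hℓ, abs_of_nonneg hℓ₁]
  refine max_le_of_balance hu (by positivity) hd hP hdP hRP hβ0 hβ1 hs rfl hγ (by positivity)
    hℓ (by positivity) ?_
  rw [← e0]
  refine h.trans ?_
  have hZ : 0 ≤ u + ℓ * (√lam * w) := by positivity
  have t1 : 2 * (ℓ₁ + 1) * D * (u + ℓ * (√lam * w))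
      ≤ 2 * (ℓ₁ + 1) * |c| * P * (u + ℓ * (√lam * w)) := by
    rw [mul_assoc (2 * (ℓ₁ + 1)) |c|]
    gcongr
  have t2 : 2 * lam * R * b ≤ 2 * (2 * α) ^ β * (R * lam ^ ((1 + β) / 2))
      * ((u + d) ^ (s * β) * (√lam * w) ^ (1 - β)) := by
    calc 2 * lam * R * b
        ≤ 2 * lam * R * ((2 * α) ^ β * (u + d) ^ (s * β) * w ^ (1 - β)) := by gcongr
      _ = 2 * R * ((2 * α) ^ β * (u + d) ^ (s * β)) * (lam * w ^ (1 - β)) := by ring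
      _ = _ := by rw [hlw]; ring
  linarith

/-- The quantity balanced against `lam`. -/
theorem rpow_balance {p q s : ℝ} (hp : 0 ≤ p) (hqs : q * (s - 1) < p + s) {lam R : ℝ}
    (hlam : 0 < lam) (hR : 0 < R) :
    R * lam ^ ((1 + (q - 1) / (p + 1)) / 2)
      = (√lam * (R ^ ((p + 1) / ((p + q) - s * (q - 1)))
        * lam ^ (s * (q - 1) / (2 * (p + q) - 2 * s * (q - 1)))))
          ^ (1 + (q - 1) / (p + 1) - s * ((q - 1) / (p + 1))) := by
  have hp1 : 0 < p + 1 := by linarith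
  have hE : 0 < (p + q) - s * (q - 1) := by linarith
  have hE2 : 2 * (p + q) - 2 * s * (q - 1) = 2 * ((p + q) - s * (q - 1)) := by ring
  have hg : 1 + (q - 1) / (p + 1) - s * ((q - 1) / (p + 1))
      = ((p + q) - s * (q - 1)) / (p + 1) := by field_simp; ring
  rw [hg, hE2]
  set E := (p + q) - s * (q - 1) with hEdef
  rw [Real.sqrt_eq_rpow, mul_left_comm, ← Real.rpow_add hlam,
    Real.mul_rpow (by positivity) (by positivity), ← Real.rpow_mul hR.le, ← Real.rpow_mul hlam.le]
  congr 1
  · rw [div_mul_div_cancel₀ hE.ne', div_self hp1.ne', Real.rpow_one]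
  · congr 1
    have : s * (q - 1) = p + q - E := by rw [hEdef]; ring
    rw [this]
    field_simp
    ring

/-- With E = (p+q) - s(q-1), the exponent (p+q)/(2E) equals 1/2 + s(q-1)/(2E). The balancing
equation thus makes d equal to √λ times the second summand of 𝓑. -/
theorem le_of_balance {p q s : ℝ} (hqs : q * (s - 1) < p + s) {lam R d : ℝ}
    (hlam : 0 < lam) (hR : 0 < R)
    (h : d = 0 ∨ d * R ^ (-((p + 1) / ((p + q) - s * (q - 1))))
      = lam ^ ((p + q) / (2 * (p + q) - 2 * s * (q - 1)))) :
    d ≤ √lam * (R ^ ((p + 1) / ((p + q) - s * (q - 1)))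
        * lam ^ (s * (q - 1) / (2 * (p + q) - 2 * s * (q - 1)))) := by
  rcases h with rfl | h
  · positivity
  have hE : 0 < (p + q) - s * (q - 1) := by linarith
  have hE2 : 2 * (p + q) - 2 * s * (q - 1) = 2 * ((p + q) - s * (q - 1)) := by ring
  rw [Real.rpow_neg hR.le, ← div_eq_mul_inv, div_eq_iff (by positivity)] at h
  rw [h, Real.sqrt_eq_rpow, mul_left_comm, ← Real.rpow_add hlam, mul_comm, hE2]
  refine le_of_eq ?_
  congr 2
  field_simp
  ring

/-- The bound in the norm of the scale's base space, by interpolation. -/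
theorem interpolated_bound {p s α C₀ : ℝ} (hp : 0 ≤ p) (hs : 0 < s) (hα : 0 < α) (hC : 0 < C₀)
    {u w d a b lam B ℒ : ℝ} (hu : 0 ≤ u) (hw : 0 ≤ w) (hd : 0 ≤ d) (hlam : 0 < lam) (hB : 0 < B)
    (hlog : 1 ≤ ℒ) (ha0 : 0 ≤ a) (ha : a ≤ 2 * α * (u + d) ^ s)
    (hb : b ≤ a ^ (1 / (p + 1)) * w ^ (1 - 1 / (p + 1)))
    (hu' : u ≤ C₀ * (√lam * B * ℒ)) (hw' : w ≤ C₀ * (B * ℒ)) (hd' : d ≤ √lam * B * ℒ) :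
    b ≤ (2 * α) ^ (1 / (p + 1)) * (C₀ + 1) ^ (s / (p + 1)) * C₀ ^ (p / (p + 1))
      * lam ^ (s / (2 * (p + 1))) * B ^ ((p + s) / (p + 1)) * ℒ ^ max 1 ((p + s) / (p + 1)) := by
  have hp1 : 0 < p + 1 := by linarith
  have hℒ : 0 < ℒ := one_pos.trans_le hlog
  have e1 : 1 - 1 / (p + 1) = p / (p + 1) := by field_simp; ring
  rw [e1] at hb
  have h1 : u + d ≤ (C₀ + 1) * (√lam * (B * ℒ)) := by
    have : (C₀ + 1) * (√lam * (B * ℒ)) = C₀ * (√lam * B * ℒ) + √lam * B * ℒ := by ring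
    linarith
  have h2 : a ^ (1 / (p + 1)) ≤ (2 * α) ^ (1 / (p + 1)) * ((C₀ + 1) ^ (s / (p + 1))
      * (lam ^ (s / (2 * (p + 1))) * (B * ℒ) ^ (s / (p + 1)))) := by
    calc a ^ (1 / (p + 1)) ≤ (2 * α * ((C₀ + 1) * (√lam * (B * ℒ))) ^ s) ^ (1 / (p + 1)) := by
          refine Real.rpow_le_rpow ha0 (ha.trans ?_) (by positivity)
          gcongr
      _ = _ := by
          rw [Real.mul_rpow (x := 2 * α) (by positivity) (by positivity),
            ← Real.rpow_mul (by positivity), mul_one_div,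
            Real.mul_rpow (x := C₀ + 1) (by positivity) (by positivity),
            Real.mul_rpow (x := √lam) (by positivity) (by positivity), Real.sqrt_eq_rpow,
            ← Real.rpow_mul hlam.le]
          congr 4
          field_simp
  have h3 : w ^ (p / (p + 1)) ≤ C₀ ^ (p / (p + 1)) * (B * ℒ) ^ (p / (p + 1)) := by
    rw [← Real.mul_rpow hC.le (by positivity)]
    exact Real.rpow_le_rpow hw hw' (by positivity)
  have h4 : (B * ℒ) ^ (s / (p + 1)) * (B * ℒ) ^ (p / (p + 1))
      = B ^ ((p + s) / (p + 1)) * ℒ ^ ((p + s) / (p + 1)) := by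
    rw [← Real.rpow_add (by positivity), ← Real.mul_rpow hB.le hℒ.le, ← add_div, add_comm]
  -- Interpolation yields the power (p+s)/(p+1) of the logarithm; it is only enlarged, using ℒ ≥ 1.
  have h5 : ℒ ^ ((p + s) / (p + 1)) ≤ ℒ ^ max 1 ((p + s) / (p + 1)) :=
    Real.rpow_le_rpow_of_exponent_le hlog (le_max_right _ _)
  refine hb.trans ((mul_le_mul h2 h3 (by positivity) (by positivity)).trans ?_)
  calc _ = (2 * α) ^ (1 / (p + 1)) * (C₀ + 1) ^ (s / (p + 1)) * C₀ ^ (p / (p + 1))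
        * lam ^ (s / (2 * (p + 1)))
        * ((B * ℒ) ^ (s / (p + 1)) * (B * ℒ) ^ (p / (p + 1))) := by ring
    _ ≤ _ := by
        rw [h4, ← mul_assoc]
        gcongr

end Rates

end

end HilbertScale

open HilbertScale

/-! ### Assembly of the three bounds -/

theorem mainTheorem1 (p q s ℓ ℓ₁ κ M Sig α N₁ : ℝ)
    (hp : 0 ≤ p) (hs : 0 < s) (hα : 0 < α) (hM : 0 < M)
    (hq₁ : 1 ≤ q) (hq₂ : q ≤ 2 + p) (hqs : q * (s - 1) < p + s) :
    ∃ C : ℝ, 0 < C ∧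
      ∀ (X : Type u) [TopologicalSpace X] [PolishSpace X] [MeasurableSpace X] [BorelSpace X]
        (Y : Type v) [NormedAddCommGroup Y] [InnerProductSpace ℝ Y] [CompleteSpace Y]
        [TopologicalSpace.SeparableSpace Y] [MeasurableSpace Y] [BorelSpace Y]
        (H : Type w) [NormedAddCommGroup H] [InnerProductSpace ℝ H] [CompleteSpace H]
        [TopologicalSpace.SeparableSpace H]
        (H' : Type t) [NormedAddCommGroup H'] [InnerProductSpace ℝ H'] [CompleteSpace H']
        [TopologicalSpace.SeparableSpace H'] [RKHS ℝ H' X Y]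
        (ρ : Measure (X × Y)) [IsProbabilityMeasure ρ] (k : Kernel X Y) [IsMarkovKernel k]
        (L : H →ₗ.[ℝ] H) (ℓL : ℝ) (hK : KernelAssumption H' κ)
        (DA : Set H) (A : H → H') (fhat : H) (fbar : L.domain) (ℓA r d θ : ℝ) (Q : Set H),
        IsSamplingModel ρ k →
        IsScaleGenerator L ℓL →
        (fbar : H) ∈ DA →
        IsTrueSolution ρ k DA A fhat →
        NoiseCondition ρ k A fhat M Sig →
        ForwardAssumption L hK ρ.fst DA A fhat ℓA r p s α d θ Q →
        ℓA / ℓL = ℓ →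
        2 * ℓA * r = ℓ₁ →
        effDim hK ρ.fst 1 = N₁ →
        ∀ (m : ℕ) (lam η R : ℝ) (fR : H),
          0 < m → 0 < lam → lam ≤ 1 → effDim hK ρ.fst lam ≤ m * lam → 0 < η → η < 1 →
          0 < R → IsDistMinimizer L q fbar fhat R fR → fR ∈ Q →
          (‖inclusion hK ρ.fst (A fR - A fhat)‖ = 0 ∨
            ‖inclusion hK ρ.fst (A fR - A fhat)‖ * R ^ (-((p + 1) / ((p + q) - s * (q - 1))))
              = lam ^ ((p + q) / (2 * (p + q) - 2 * s * (q - 1)))) →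
          ∃ S : Set (Fin m → X × Y), MeasurableSet S ∧
            1 - η ≤ (Measure.pi fun _ : Fin m => ρ).real S ∧
            ∀ z ∈ S, ∀ f : L.domain, IsTikhonovEstimator L DA A fbar z lam f → (f : H) ∈ Q →
              ‖inclusion hK ρ.fst (A f - A fR)‖ ≤
                  C * lam ^ (1 / 2 : ℝ) * errorTerm p q s (effDim hK ρ.fst lam) m lam R
                    * Real.log (4 / η) ∧
              (∃ h : (f : H) - fR ∈ L.domain, ‖L ⟨(f : H) - fR, h⟩‖ ≤
                  C * errorTerm p q s (effDim hK ρ.fst lam) m lam R * Real.log (4 / η)) ∧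
              ‖(f : H) - fR‖ ≤
                  C * lam ^ (s / (2 * (p + 1)))
                    * errorTerm p q s (effDim hK ρ.fst lam) m lam R ^ ((p + s) / (p + 1))
                    * Real.log (4 / η) ^ max 1 ((p + s) / (p + 1)) := by
  set c := concConst κ M Sig N₁ with hc
  set C₀ := rateConst p q s ℓ ℓ₁ α c with hC₀
  have hC₀pos : 0 < C₀ := rateConst_pos p q s ℓ ℓ₁ α c
  set C₁ := (2 * α) ^ (1 / (p + 1)) * (C₀ + 1) ^ (s / (p + 1)) * C₀ ^ (p / (p + 1)) with hC₁
  have hC₁0 : 0 ≤ C₁ := by positivity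
  have hp1 : 0 < p + 1 := by linarith
  -- C₀ serves the first two bounds, C₁ the third.
  refine ⟨C₀ + C₁, by positivity, ?_⟩
  intro X _ _ _ _ Y _ _ _ _ _ _ H _ _ _ _ H' _ _ _ _ _ ρ _ k _ L ℓL hK DA A fhat fbar ℓA r d θ Q
    hρ hL hfbar hf hnoise hA hℓ hℓ₁ hN₁ m lam η R fR hm hlam hlam1 hNm hη hη1 hR hfR hfRQ hbal
  have hm' : (0 : ℝ) < m := by exact_mod_cast hm
  have hsl : 0 < √lam := Real.sqrt_pos.2 hlam
  obtain ⟨S, hS, hSη, hSz⟩ := exists_concentration_event hK ρ hρ hf hM hnoise hlam hlam1 hm hNm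
    hη hη1
  refine ⟨S, hS, hSη, fun z hz f hest hfQ => ?_⟩
  obtain ⟨hn, he⟩ := hSz z hz
  rw [hN₁, ← hc] at hn he
  set N := effDim hK ρ.fst lam with hN
  set ℒ := Real.log (4 / η) with hℒ
  have hℒ1 : 1 ≤ ℒ := one_le_log_four_div hη hη1
  obtain ⟨⟨v, hv, hvR⟩, -⟩ := hfR
  -- Splitting L^{-q} = L^{-1}L^{-(q-1)}, possible since q ≥ 1, puts f̂^R in 𝒟(L) and identifies
  -- L(f̂^R - f̄).
  have hv' : fR - fbar = invOp L (negPow L (q - 1) v) := by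
    rw [hv, ← negPow_one L, ← mul_apply_eq_comp, ← hL.negPow_add zero_le_one (by linarith),
      add_sub_cancel]
  have hgdom : fR ∈ L.domain := by
    have h1 := L.domain.add_mem (hL.mem_domain (negPow L (q - 1) v)) fbar.2
    rwa [← hv', sub_add_cancel] at h1
  set g : L.domain := ⟨fR, hgdom⟩ with hg
  have hLg : L (g - fbar) = negPow L (q - 1) v := by
    have h1 := hL.apply_invOp _ (hL.mem_domain (negPow L (q - 1) v))
    rw [← h1]
    congr 1
    exact Subtype.ext hv'
  set B₁ := R ^ ((p + 1) / ((p + q) - s * (q - 1))) *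
    lam ^ (s * (q - 1) / (2 * (p + q) - 2 * s * (q - 1))) with hB₁
  have hB₁pos : 0 < B₁ := by positivity
  set B := errorTerm p q s N m lam R with hB
  have hBeq : B = √(N / (m * lam)) + B₁ := rfl
  have hBpos : 0 < B := by rw [hBeq]; positivity
  have hB₁B : B₁ ≤ B := by rw [hBeq]; linarith [Real.sqrt_nonneg (N / (m * lam))]
  set P := √lam * B * ℒ with hPdef
  have hℒ0 : 0 < ℒ := one_pos.trans_le hℒ1
  have hPpos : 0 < P := by positivity
  have hB₁P : √lam * B₁ ≤ P := by
    have h1 : √lam * B₁ ≤ √lam * B := by gcongr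
    exact h1.trans (le_mul_of_one_le_right (by positivity) hℒ1)
  have hN0 : 0 ≤ N := effDim_nonneg hK ρ.fst hlam
  -- Rewrites the concentration radius as m D, where D is at most |c|P because √(N/(mλ)) is the
  -- first summand of 𝓑.
  have hroot : √(m * N) = m * (√lam * √(N / (m * lam))) := by
    rw [← Real.sqrt_mul hlam.le, ← Real.sqrt_sq hm'.le, ← Real.sqrt_mul (sq_nonneg _),
      Real.sqrt_sq hm'.le]
    congr 1
    field_simp
  set D := c * (√lam * √(N / (m * lam))) * ℒ with hD
  have hDeq : c * √(m * N) * ℒ = m * D := by rw [hroot, hD]; ring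
  rw [hDeq] at hn he
  have hDP : D ≤ |c| * P := by
    have h1 : √(N / (m * lam)) ≤ B := by rw [hBeq]; linarith
    calc D ≤ |c| * (√lam * √(N / (m * lam))) * ℒ := by
          rw [hD]
          gcongr
          exact le_abs_self c
      _ ≤ |c| * (√lam * B) * ℒ := by gcongr
      _ = |c| * P := by rw [hPdef]; ring
  have hfhat : fhat ∈ DA := interior_subset hf.mem_interior
  have hineq := estimator_inequality hL hlam hfhat hA hm hest hfQ hfRQ (g := g) hLg hvR hn he
  rw [hℓ, hℓ₁] at hineq
  have hℓ0 : 0 ≤ ℓ := by rw [← hℓ]; exact div_nonneg hA.lipschitz_nonneg hL.lower_pos.le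
  have hℓ₁0 : 0 ≤ ℓ₁ := by
    rw [← hℓ₁]
    have := hA.lipschitz_nonneg
    have := hA.radius_pos
    positivity
  have hstab := norm_negPow_add_one_le hL hp hs hα hA (f := f) (g := g) hfQ hfRQ
  -- Two interpolations of L(f - g) against exponent p + 1: order q - 1 for the penalty cross term,
  -- order 1 for ‖f - g‖ itself.
  have hint1 := hL.norm_negPow_interpolation (a := q - 1) (b := p + 1) (by linarith) hp1
    (by linarith) (L (f - g))
  have hint2 := hL.norm_negPow_interpolation (a := 1) (b := p + 1) zero_le_one hp1
    (by linarith) (L (f - g))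
  rw [negPow_one, hL.invOp_apply, Submodule.coe_sub] at hint2
  have hdP : ‖inclusion hK ρ.fst (A fR - A fhat)‖ ≤ P :=
    (le_of_balance hqs hlam hR hbal).trans hB₁P
  have hγ : 0 ≤ 1 + (q - 1) / (p + 1) - s * ((q - 1) / (p + 1)) := by
    have : 1 + (q - 1) / (p + 1) - s * ((q - 1) / (p + 1))
        = (p + s - q * (s - 1)) / (p + 1) := by field_simp; ring
    rw [this]
    exact div_nonneg (by linarith) hp1.le
  have hRP : R * lam ^ ((1 + (q - 1) / (p + 1)) / 2)
      ≤ P ^ (1 + (q - 1) / (p + 1) - s * ((q - 1) / (p + 1))) := by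
    rw [rpow_balance hp hqs hlam hR]
    exact Real.rpow_le_rpow (by positivity) hB₁P hγ
  have hmax := max_le_rateConst_mul hp hs hα hq₁ hq₂ hqs hℓ0 hℓ₁0 (norm_nonneg _) (norm_nonneg _)
    (norm_nonneg _) hlam hR hPpos hdP hDP (norm_nonneg _) hRP hstab hint1 hineq
  rw [← hC₀] at hmax
  have hu := (le_max_left _ _).trans hmax
  have hw : ‖L (f - g)‖ ≤ C₀ * (B * ℒ) := by
    refine le_of_mul_le_mul_left (a := √lam) (((le_max_right _ _).trans hmax).trans_eq ?_) hsl
    rw [hPdef]; ring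
  have hthird := interpolated_bound hp hs hα hC₀pos (norm_nonneg _) (norm_nonneg _)
    (norm_nonneg _) hlam hBpos hℒ1 (norm_nonneg _) hstab hint2 hu hw hdP
  rw [← hC₁] at hthird
  refine ⟨hu.trans ?_, ⟨(f - g).2, hw.trans ?_⟩, hthird.trans ?_⟩
  · rw [hPdef, ← Real.sqrt_eq_rpow]
    calc _ = C₀ * √lam * B * ℒ := by ring
      _ ≤ _ := by gcongr; linarith
  · calc _ = C₀ * B * ℒ := by ring
      _ ≤ _ := by gcongr; linarith
  · gcongr
    linarith
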